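/- Let $n\ge 2$, let $\Omega\subset\mathbb{R}^n$ be a bounded domain (nonempty, open, connected) with Lipschitz boundary, and let $A\subset\subset\Omega$ be an open set with Lipschitz boundary and finitely many connected components such that $B:=\Omega\setminus\overline A$ is a domain. Let $1<p,q<+\infty$, $p\neq q$, and let $Q_B:B\times[0,+\infty)\to\mathbb{R}$, $Q_A:A\times[0,+\infty)\to\mathbb{R}$ satisfy: (A1) $Q_B$ and $Q_A$ are Carathéodory functions: $x\mapsto Q_B(x,E)$ is measurable on $B$ for every $E\ge0$, $E\mapsto Q_B(x,E)$ is continuous on $[0,+\infty)$ for a.e. $x\in B$, and likewise for $Q_A$ on $A$. (A2) For a.e. $x\in B$ (resp. a.e. $x\in A$), the function $E\mapsto Q_B(x,E)$ (resp. $E\mapsto Q_A(x,E)$) is nonnegative, $C^1$ and strictly convex on $[0,+\infty)$, and vanishes at $E=0$. (A3) There exist exponents $1<p_0\le p$, $1<q_0\le q$ with $p_0\ne q_0$ and constants $\underline Q,\overline Q,E_0>0$ such that for all $E\ge 0$ $$\underline Q\max\Big\{\big(\tfrac{E}{E_0}\big)^{p_0},\big(\tfrac{E}{E_0}\big)^{p}\Big\}\le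 Q_B(x,E)\le \overline Q\max\Big\{\big(\tfrac{E}{E_0}\big)^{p_0},\big(\tfrac{E}{E_0}\big)^{p}\Big\}\quad\text{for a.e. }x\in B,$$ $$\underline Q\max\Big\{\big(\tfrac{E}{E_0}\big)^{q_0},\big(\tfrac{E}{E_0}\big)^{q}\Big\}\le Q_A(x,E)\le \overline Q\max\Big\{\big(\tfrac{E}{E_0}\big)^{q_0},\big(\tfrac{E}{E_0}\big)^{q}\Big\}\quad\text{for a.e. }x\in A.$$ For $1<s<+\infty$ let $W^{1,s}_0(\Omega)$ be the closure in $W^{1,s}(\Omega)$ of the $C^1$ functions with compact support in $\Omega$. Let $X^p(\partial\Omega)$ be the abstract trace space, whose elements are the functions in $W^{1,p}(\Omega)$ modulo the relation $f-g\in W^{1,p}_0(\Omega)$, and let $X^p_\diamond(\partial\Omega)$ be the set of those elements whose trace on $\partial\Omega$ has zero average with respect to the $(n-1)$-dimensional Hausdorff measure. For $f\in X^p_\diamond(\partial\Omega)$ and $u\in W^{1,p}(\Omega)\cup W^{1,q}(\Omega)$, write $u|_{\partial\Omega}=f$ if $u-f\in W^{1,p}_0(\Omega)\cup W^{1,q}_0(\Omega)$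 (with $f$ identified with a representative in $W^{1,p}(\Omega)$), and let $$\mathbb{E}_\sigma(u)=\int_B Q_B(x,|\nabla u(x)|)\,dx+\int_A Q_A(x,|\nabla u(x)|)\,dx\in[0,+\infty].$$ Then for every $f\in X^p_\diamond(\partial\Omega)$ the minimum problem $$\min\{\mathbb{E}_\sigma(u)\ :\ u\in W^{1,p}(\Omega)\cup W^{1,q}(\Omega),\ u|_{\partial\Omega}=f\}$$ has exactly one solution (as a class of functions modulo equality a.e. in $\Omega$), and this solution belongs to $W^{1,\min\{p,q\}}(\Omega)$. -/

import Mathlib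

open MeasureTheory Set
open scoped ENNReal NNReal ContDiff

noncomputable section

namespace TwoPhase

/-- Euclidean space `ℝⁿ`. -/
abbrev Rn (n : ℕ) : Type := EuclideanSpace ℝ (Fin n)

/-- Classes of real functions on `Ω` modulo equality almost everywhere in `Ω`. -/
abbrev Fun {n : ℕ} (Ω : Set (Rn n)) : Type := Rn n →ₘ[volume.restrict Ω] ℝ

/-- `U` has Lipschitz boundary: near every boundary point, in suitable Cartesian coordinates whose
last axis points in the direction `ν`, the set `U` is the region strictly above the graph of a
Lipschitz function of the other `n - 1` coordinates (`y - ⟪ν, y⟫ ν` is the orthogonal projection of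
`y` on the hyperplane `ν^⊥`). -/
def HasLipschitzBoundary {n : ℕ} (U : Set (Rn n)) : Prop :=
  ∀ x ∈ frontier U, ∃ ν : Rn n, ‖ν‖ = 1 ∧ ∃ r : ℝ, 0 < r ∧ ∃ (K : ℝ≥0) (γ : Rn n → ℝ),
    LipschitzWith K γ ∧
      ∀ y ∈ Metric.ball x r, y ∈ U ↔ γ (y - inner ℝ ν y • ν) < inner ℝ ν y

/-! ### Sobolev spaces -/

/-- `G` is the weak (distributional) gradient of `u` in the open set `Ω`. -/
structure IsWeakGradient {n : ℕ} (Ω : Set (Rn n)) (u : Rn n → ℝ) (G : Rn n → Rn n) : Prop where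
  locallyIntegrable : LocallyIntegrableOn u Ω volume
  locallyIntegrable_grad : LocallyIntegrableOn G Ω volume
  integral_eq : ∀ φ : Rn n → ℝ, ContDiff ℝ ∞ φ → HasCompactSupport φ → tsupport φ ⊆ Ω →
    ∀ v : Rn n, ∫ x in Ω, u x * fderiv ℝ φ x v = -∫ x in Ω, inner ℝ (G x) v * φ x

section helpers

variable {n : ℕ} {Ω : Set (Rn n)}

lemma locallyIntegrableOn_congr {F : Type*} [NormedAddCommGroup F] {f g : Rn n → F}
    (h : f =ᵐ[volume.restrict Ω] g) (hf : LocallyIntegrableOn f Ω volume) :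
    LocallyIntegrableOn g Ω volume := by
  intro x hx
  obtain ⟨s, hs, hfs⟩ := hf x hx
  refine ⟨s ∩ Ω, Filter.inter_mem hs self_mem_nhdsWithin, ?_⟩
  have h1 : IntegrableOn f (s ∩ Ω) volume := hfs.mono_set inter_subset_left
  exact h1.congr (ae_restrict_of_ae_restrict_of_subset inter_subset_right h)

lemma integrableOn_mul_of_compact {u φ : Rn n → ℝ} (hu : LocallyIntegrableOn u Ω volume)
    (hφ : Continuous φ) (hc : HasCompactSupport φ) (hs : tsupport φ ⊆ Ω) :
    IntegrableOn (fun x => u x * φ x) Ω volume := by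
  have hK : IntegrableOn u (tsupport φ) volume := hu.integrableOn_compact_subset hs hc
  have h1 : IntegrableOn (fun x => u x * φ x) (tsupport φ) volume :=
    hK.mul_continuousOn hφ.continuousOn hc
  have h2 : Integrable (fun x => u x * φ x) volume := by
    refine (integrableOn_iff_integrable_of_support_subset ?_).1 h1
    intro x hx
    apply subset_tsupport φ
    intro h0
    exact hx (by simp [h0])
  exact h2.integrableOn

lemma integrable_mul_fderiv {u φ : Rn n → ℝ} (hu : LocallyIntegrableOn u Ω volume)
    (hφ : ContDiff ℝ ∞ φ) (hc : HasCompactSupport φ) (hs : tsupport φ ⊆ Ω) (v : Rn n) :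
    IntegrableOn (fun x => u x * fderiv ℝ φ x v) Ω volume := by
  have hcont : Continuous (fun x => fderiv ℝ φ x v) :=
    (hφ.continuous_fderiv (by simp)).clm_apply continuous_const
  refine integrableOn_mul_of_compact hu hcont (hc.fderiv_apply ℝ v) ?_
  exact (tsupport_fderiv_apply_subset ℝ v).trans hs

lemma locallyIntegrableOn_inner {G : Rn n → Rn n} (hG : LocallyIntegrableOn G Ω volume)
    (v : Rn n) : LocallyIntegrableOn (fun x => inner ℝ (G x) v) Ω volume := by
  intro x hx
  obtain ⟨s, hs, hGs⟩ := hG x hx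
  exact ⟨s, hs, hGs.inner_const v⟩

namespace IsWeakGradient

lemma congr {u w : Rn n → ℝ} {G : Rn n → Rn n} (h : IsWeakGradient Ω u G)
    (huw : u =ᵐ[volume.restrict Ω] w) : IsWeakGradient Ω w G := by
  refine ⟨locallyIntegrableOn_congr huw h.1, h.2, fun φ h1 h2 h3 v => ?_⟩
  rw [← h.3 φ h1 h2 h3 v]
  refine integral_congr_ae ?_
  filter_upwards [huw] with x hx
  rw [hx]

lemma zero : IsWeakGradient Ω 0 0 :=
  ⟨(locallyIntegrable_zero).locallyIntegrableOn Ω, (locallyIntegrable_zero).locallyIntegrableOn Ω,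
    fun φ _ _ _ v => by simp⟩

lemma add {u w : Rn n → ℝ} {G H : Rn n → Rn n} (h : IsWeakGradient Ω u G)
    (k : IsWeakGradient Ω w H) : IsWeakGradient Ω (u + w) (G + H) := by
  refine ⟨h.1.add k.1, h.2.add k.2, fun φ h1 h2 h3 v => ?_⟩
  have e1 := integral_add (integrable_mul_fderiv h.1 h1 h2 h3 v)
    (integrable_mul_fderiv k.1 h1 h2 h3 v)
  have e2 := integral_add
    (integrableOn_mul_of_compact (locallyIntegrableOn_inner h.2 v) h1.continuous h2 h3)
    (integrableOn_mul_of_compact (locallyIntegrableOn_inner k.2 v) h1.continuous h2 h3)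
  rw [h.3 φ h1 h2 h3 v, k.3 φ h1 h2 h3 v] at e1
  simp only [Pi.add_apply, add_mul, inner_add_left] at e1 e2 ⊢
  rw [e1, e2]
  ring

lemma smul {u : Rn n → ℝ} {G : Rn n → Rn n} (c : ℝ) (h : IsWeakGradient Ω u G) :
    IsWeakGradient Ω (c • u) (c • G) := by
  refine ⟨h.1.smul c, h.2.smul c, fun φ h1 h2 h3 v => ?_⟩
  have e := h.3 φ h1 h2 h3 v
  simp only [Pi.smul_apply, smul_eq_mul, inner_smul_left, mul_assoc, integral_const_mul, e]
  simp

end IsWeakGradient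

end helpers

/-- The Sobolev space `W^{1,s}(Ω)`, a space of classes of functions on `Ω` modulo equality a.e. -/
def sobolev {n : ℕ} (Ω : Set (Rn n)) (s : ℝ) : Submodule ℝ (Fun Ω) where
  carrier := {u | ∃ G : Rn n → Rn n, IsWeakGradient Ω u G ∧
    MemLp u (ENNReal.ofReal s) (volume.restrict Ω) ∧
    MemLp G (ENNReal.ofReal s) (volume.restrict Ω)}
  zero_mem' :=
    ⟨0, IsWeakGradient.zero.congr AEEqFun.coeFn_zero.symm,
      (memLp_congr_ae AEEqFun.coeFn_zero).2 MemLp.zero, MemLp.zero⟩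
  add_mem' := by
    rintro u w ⟨G, h1, h2, h3⟩ ⟨H, k1, k2, k3⟩
    exact ⟨G + H, (h1.add k1).congr (AEEqFun.coeFn_add u w).symm,
      (memLp_congr_ae (AEEqFun.coeFn_add u w)).2 (h2.add k2), h3.add k3⟩
  smul_mem' := by
    rintro c u ⟨G, h1, h2, h3⟩
    exact ⟨c • G, (h1.smul c).congr (AEEqFun.coeFn_smul c u).symm,
      (memLp_congr_ae (AEEqFun.coeFn_smul c u)).2 (h2.const_smul c), h3.const_smul c⟩

/-- The `C¹` functions with compact support contained in `Ω`. -/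
structure IsTestC1 {n : ℕ} (Ω : Set (Rn n)) (φ : Rn n → ℝ) : Prop where
  contDiff : ContDiff ℝ 1 φ
  compact : HasCompactSupport φ
  support : tsupport φ ⊆ Ω

section helpers

variable {n : ℕ}

lemma continuous_gradient {φ : Rn n → ℝ} (h : ContDiff ℝ 1 φ) : Continuous (gradient φ) :=
  (InnerProductSpace.toDual ℝ (Rn n)).symm.continuous.comp (h.continuous_fderiv (by simp))

lemma gradient_add {φ ψ : Rn n → ℝ} (h : ContDiff ℝ 1 φ) (k : ContDiff ℝ 1 ψ) :
    gradient (φ + ψ) = gradient φ + gradient ψ := by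
  funext x
  simp [gradient, fderiv_add (h.differentiable (by simp) x) (k.differentiable (by simp) x)]

lemma gradient_smul {φ : Rn n → ℝ} (c : ℝ) (h : ContDiff ℝ 1 φ) :
    gradient (c • φ) = c • gradient φ := by
  funext x
  simp [gradient, fderiv_const_smul (h.differentiable (by simp) x) c]

end helpers

/-- `W₀^{1,s}(Ω)`: the closure in `W^{1,s}(Ω)`, for the `W^{1,s}` norm, of the `C¹` functions with
compact support in `Ω`. -/
def sobolevZero {n : ℕ} (Ω : Set (Rn n)) (s : ℝ) : Submodule ℝ (Fun Ω) where
  carrier := {u | ∃ G : Rn n → Rn n, IsWeakGradient Ω u G ∧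
    MemLp u (ENNReal.ofReal s) (volume.restrict Ω) ∧
    MemLp G (ENNReal.ofReal s) (volume.restrict Ω) ∧
    ∀ ε : ℝ≥0∞, 0 < ε → ∃ φ : Rn n → ℝ, IsTestC1 Ω φ ∧
      eLpNorm ((u : Rn n → ℝ) - φ) (ENNReal.ofReal s) (volume.restrict Ω) ≤ ε ∧
      eLpNorm (G - gradient φ) (ENNReal.ofReal s) (volume.restrict Ω) ≤ ε}
  zero_mem' := by
    refine ⟨0, IsWeakGradient.zero.congr AEEqFun.coeFn_zero.symm,
      (memLp_congr_ae AEEqFun.coeFn_zero).2 MemLp.zero, MemLp.zero, fun ε _ => ⟨0, ?_, ?_, ?_⟩⟩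
    · exact ⟨contDiff_const, HasCompactSupport.zero, by simp [tsupport]⟩
    · rw [sub_zero, eLpNorm_congr_ae AEEqFun.coeFn_zero]
      simp
    · have : gradient (0 : Rn n → ℝ) = 0 := by
        funext x
        simp [gradient]
      simp [this]
  add_mem' := by
    rintro u w ⟨G, h1, h2, h3, h4⟩ ⟨H, k1, k2, k3, k4⟩
    refine ⟨G + H, (h1.add k1).congr (AEEqFun.coeFn_add u w).symm,
      (memLp_congr_ae (AEEqFun.coeFn_add u w)).2 (h2.add k2), h3.add k3, fun ε hε => ?_⟩
    obtain ⟨η, hη, hadd⟩ := exists_Lp_half (ε := ℝ) (μ := volume.restrict Ω) (ENNReal.ofReal s) hε.ne'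
    obtain ⟨η', hη', hadd'⟩ :=
      exists_Lp_half (ε := Rn n) (μ := volume.restrict Ω) (ENNReal.ofReal s) hε.ne'
    obtain ⟨φ, hφ, a1, a2⟩ := h4 (min η η') (lt_min hη hη')
    obtain ⟨ψ, hψ, b1, b2⟩ := k4 (min η η') (lt_min hη hη')
    refine ⟨φ + ψ, ⟨hφ.1.add hψ.1, hφ.2.add hψ.2,
      (tsupport_add φ ψ).trans (union_subset hφ.3 hψ.3)⟩, ?_, ?_⟩
    · have e : ((u + w : Fun Ω) : Rn n → ℝ) - (φ + ψ) =ᵐ[volume.restrict Ω]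
          ((u : Rn n → ℝ) - φ) + ((w : Rn n → ℝ) - ψ) := by
        filter_upwards [AEEqFun.coeFn_add u w] with x hx
        simp only [Pi.sub_apply, Pi.add_apply, hx]
        ring
      rw [eLpNorm_congr_ae e]
      exact (hadd _ _ (h2.1.sub hφ.1.continuous.aestronglyMeasurable)
        (k2.1.sub hψ.1.continuous.aestronglyMeasurable)
        (a1.trans (min_le_left _ _)) (b1.trans (min_le_left _ _))).le
    · rw [gradient_add hφ.1 hψ.1, add_sub_add_comm]
      exact (hadd' _ _ (h3.1.sub (continuous_gradient hφ.1).aestronglyMeasurable)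
        (k3.1.sub (continuous_gradient hψ.1).aestronglyMeasurable)
        (a2.trans (min_le_right _ _)) (b2.trans (min_le_right _ _))).le
  smul_mem' := by
    rintro c u ⟨G, h1, h2, h3, h4⟩
    refine ⟨c • G, (h1.smul c).congr (AEEqFun.coeFn_smul c u).symm,
      (memLp_congr_ae (AEEqFun.coeFn_smul c u)).2 (h2.const_smul c), h3.const_smul c,
      fun ε hε => ?_⟩
    obtain ⟨φ, hφ, a1, a2⟩ := h4 (ε / ‖c‖ₑ) (ENNReal.div_pos hε.ne' enorm_ne_top)
    have hmul : ‖c‖ₑ * (ε / ‖c‖ₑ) ≤ ε := ENNReal.mul_div_le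
    refine ⟨c • φ, ⟨hφ.1.const_smul c, hφ.2.smul_left (f := fun _ => c),
      (closure_mono (Function.support_const_smul_subset c φ)).trans hφ.3⟩, ?_, ?_⟩
    · have e : ((c • u : Fun Ω) : Rn n → ℝ) - c • φ =ᵐ[volume.restrict Ω]
          c • ((u : Rn n → ℝ) - φ) := by
        filter_upwards [AEEqFun.coeFn_smul c u] with x hx
        simp only [Pi.sub_apply, Pi.smul_apply, hx, smul_sub]
      rw [eLpNorm_congr_ae e, eLpNorm_const_smul]
      exact (mul_le_mul_right a1 _).trans hmul
    · rw [gradient_smul c hφ.1, ← smul_sub, eLpNorm_const_smul]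
      exact (mul_le_mul_right a2 _).trans hmul

open Classical in
/-- The weak gradient `∇u` of `u` in `Ω`; it is determined up to equality a.e. in the open set `Ω`
(and is given the value `0` if `u` is not weakly differentiable). -/
def weakGradient {n : ℕ} (Ω : Set (Rn n)) (u : Fun Ω) : Rn n → Rn n :=
  if h : ∃ G : Rn n → Rn n, IsWeakGradient Ω u G then h.choose else 0

/-! ### Boundary data -/

/-- The abstract trace space `X^p(∂Ω)`: functions in `W^{1,p}(Ω)` modulo the relation
`f - g ∈ W₀^{1,p}(Ω)`. -/
abbrev TraceSpace {n : ℕ} (Ω : Set (Rn n)) (p : ℝ) : Type :=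
  sobolev Ω p ⧸ (sobolevZero Ω p).submoduleOf (sobolev Ω p)

/-- The surface measure `dS` on `∂Ω`, i.e. the `(n-1)`-dimensional Hausdorff measure. -/
def surfaceMeasure {n : ℕ} (Ω : Set (Rn n)) : Measure (Rn n) :=
  (Measure.euclideanHausdorffMeasure (n - 1)).restrict (frontier Ω)

/-- `t ∈ L^p(∂Ω, dS)` is the trace on `∂Ω` of `g ∈ W^{1,p}(Ω)`: there are functions `φ` of class
`C¹` up to the boundary which are simultaneously close to `g` in `W^{1,p}(Ω)` and to `t` in
`L^p(∂Ω, dS)`. -/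
def IsTrace {n : ℕ} (Ω : Set (Rn n)) (p : ℝ) (g : Fun Ω) (t : Rn n → ℝ) : Prop :=
  MemLp t (ENNReal.ofReal p) (surfaceMeasure Ω) ∧
  ∃ G : Rn n → Rn n, IsWeakGradient Ω g G ∧
    MemLp g (ENNReal.ofReal p) (volume.restrict Ω) ∧
    MemLp G (ENNReal.ofReal p) (volume.restrict Ω) ∧
    ∀ ε : ℝ≥0∞, 0 < ε → ∃ φ : Rn n → ℝ, ContDiff ℝ 1 φ ∧
      eLpNorm ((g : Rn n → ℝ) - φ) (ENNReal.ofReal p) (volume.restrict Ω) ≤ ε ∧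
      eLpNorm (G - gradient φ) (ENNReal.ofReal p) (volume.restrict Ω) ≤ ε ∧
      eLpNorm (t - φ) (ENNReal.ofReal p) (surfaceMeasure Ω) ≤ ε

/-- `X^p_⋄(∂Ω)`: the elements of `X^p(∂Ω)` with zero average on `∂Ω` with respect to `dS`. -/
def TraceSpaceZeroMean {n : ℕ} (Ω : Set (Rn n)) (p : ℝ) : Set (TraceSpace Ω p) :=
  {f | ∃ (g : sobolev Ω p) (t : Rn n → ℝ), Submodule.Quotient.mk g = f ∧
    IsTrace Ω p (g : Fun Ω) t ∧ ∫ x, t x ∂(surfaceMeasure Ω) = 0}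

/-- The boundary condition `u|_{∂Ω} = f`, i.e. `u - f ∈ W₀^{1,p}(Ω) ∪ W₀^{1,q}(Ω)`, where `f` is
represented by a function `g ∈ W^{1,p}(Ω)`. -/
def HasBoundaryValue {n : ℕ} (Ω : Set (Rn n)) (p q : ℝ) (u : Fun Ω) (f : TraceSpace Ω p) : Prop :=
  ∃ g : sobolev Ω p, Submodule.Quotient.mk g = f ∧
    u - (g : Fun Ω) ∈ (sobolevZero Ω p : Set (Fun Ω)) ∪ sobolevZero Ω q

/-! ### The Dirichlet energy and the assumptions on its densities -/

/-- The Dirichlet energy `∫_B Q_B(x,|∇u(x)|) dx + ∫_A Q_A(x,|∇u(x)|) dx`, `B = Ω \ closure A`, with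
values in `[0,∞]` (the densities are nonnegative). -/
def dirichletEnergy {n : ℕ} (Ω A : Set (Rn n)) (QB QA : Rn n → ℝ → ℝ) (u : Fun Ω) : ℝ≥0∞ :=
  (∫⁻ x in Ω \ closure A, ENNReal.ofReal (QB x ‖weakGradient Ω u x‖)) +
    ∫⁻ x in A, ENNReal.ofReal (QA x ‖weakGradient Ω u x‖)

/-- `Q : U × [0,∞) → ℝ` is a Carathéodory function (`x ↦ Q(x,E)` is Lebesgue measurable on `U`). -/
def IsCaratheodory {n : ℕ} (U : Set (Rn n)) (Q : Rn n → ℝ → ℝ) : Prop :=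
  (∀ E : ℝ, 0 ≤ E → AEMeasurable (fun x => Q x E) (volume.restrict U)) ∧
    ∀ᵐ x ∂(volume.restrict U), ContinuousOn (Q x) (Ici 0)

/-- For a.e. `x ∈ U`, the function `E ↦ Q(x,E)` is nonnegative, `C¹` and strictly convex on `[0,∞)`,
and vanishes at `E = 0`. -/
def IsConvexDensity {n : ℕ} (U : Set (Rn n)) (Q : Rn n → ℝ → ℝ) : Prop :=
  ∀ᵐ x ∂(volume.restrict U), (∀ E : ℝ, 0 ≤ E → 0 ≤ Q x E) ∧ ContDiffOn ℝ 1 (Q x) (Ici 0) ∧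
    StrictConvexOn ℝ (Ici 0) (Q x) ∧ Q x 0 = 0

/-- Two-sided growth:
`c max{(E/E₀)^{s₀}, (E/E₀)^s} ≤ Q(x,E) ≤ C max{(E/E₀)^{s₀}, (E/E₀)^s}` for a.e. `x ∈ U`, all
`E ≥ 0`. -/
def HasGrowth {n : ℕ} (U : Set (Rn n)) (Q : Rn n → ℝ → ℝ) (s₀ s c C E₀ : ℝ) : Prop :=
  ∀ᵐ x ∂(volume.restrict U), ∀ E : ℝ, 0 ≤ E →
    c * max ((E / E₀) ^ s₀) ((E / E₀) ^ s) ≤ Q x E ∧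
      Q x E ≤ C * max ((E / E₀) ^ s₀) ((E / E₀) ^ s)

/-- The admissible functions: `u ∈ W^{1,p}(Ω) ∪ W^{1,q}(Ω)` with `u|_{∂Ω} = f`. -/
def admissible {n : ℕ} (Ω : Set (Rn n)) (p q : ℝ) (f : TraceSpace Ω p) : Set (Fun Ω) :=
  {u | u ∈ (sobolev Ω p : Set (Fun Ω)) ∪ sobolev Ω q ∧ HasBoundaryValue Ω p q u f}

/-- `u` solves the minimum problem: `u` is admissible and minimizes the Dirichlet energy among all
admissible functions. -/
def IsSolution {n : ℕ} (Ω A : Set (Rn n)) (QB QA : Rn n → ℝ → ℝ) (p q : ℝ) (f : TraceSpace Ω p)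
    (u : Fun Ω) : Prop :=
  u ∈ admissible Ω p q f ∧ IsMinOn (dirichletEnergy Ω A QB QA) (admissible Ω p q f) u

end TwoPhase

end

open MeasureTheory Set Filter Topology
open scoped ENNReal NNReal ContDiff

namespace TwoPhase

/-! ### Strictly convex functions of the norm -/

section Convex

variable {E : Type*} [NormedAddCommGroup E] [NormedSpace ℝ E]

/-! Let `m = min p q` and let `g` represent `f`. On a bounded domain the spaces `W₀^{1,s}` decrease
in `s`, so the union in the boundary condition collapses and the admissible set is the affine space
`g + W₀^{1,m}` (`mem_admissible_iff`). The energy depends only on the gradient. By the Poincaré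
inequality, `u ↦ ∇u` is a bijection from this affine space onto a closed convex subset of `L^m`,
namely a translate of the closure of the gradients of test functions. The problem thus becomes the
minimization of an integral functional over that set (`existsUnique_isMinOn`).

There the direct method applies. Each density is increasing and strictly convex, so the functional
is convex; Fatou's lemma makes its sublevel sets closed, and the lower growth bound makes them
bounded in `L^m`. Instead of weak compactness, the quantitative uniform convexity of `L^m` shows
that nested bounded closed convex sets have a common point (`nonempty_iInter_of_midpoint_convex`).
Uniqueness follows by comparing two minimizers with their midpoint.

The infimum must also be finite. This is not automatic: if `q > p`, the datum `g` may have infinite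
energy in `A`. Since `A` is compactly contained in `Ω`, multiplying `g` by a cutoff gives a
competitor whose gradient vanishes in `A` and is in `L^p` elsewhere (`exists_vanishing_competitor`).
-/

lemma strictMonoOn_of_strictConvexOn {Q : ℝ → ℝ} (hQ : StrictConvexOn ℝ (Ici 0) Q)
    (h0 : ∀ t, 0 ≤ t → 0 ≤ Q t) (hz : Q 0 = 0) : StrictMonoOn Q (Ici 0) := by
  intro s hs t ht hst
  have ht0 : 0 < t := lt_of_le_of_lt hs hst
  have h2 : 0 < 1 - s / t := by
    rw [sub_pos, div_lt_one ht0]; exact hst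
  -- If `s = 0`, convexity at the midpoint gives `0 ≤ Q (t / 2) < Q t / 2`. If `s > 0`, then `s` is
  -- a proper combination of `0` and `t`, whence `Q s < (s / t) Q t ≤ Q t`.
  rcases eq_or_lt_of_le (show 0 ≤ s from hs) with h | h
  · subst h
    have := hQ.2 (mem_Ici.2 (le_refl (0 : ℝ))) ht hst.ne
      (show (0 : ℝ) < 1 / 2 by norm_num) (show (0 : ℝ) < 1 / 2 by norm_num) (by norm_num)
    simp only [smul_eq_mul, mul_zero, zero_add, hz] at this
    have := h0 (1 / 2 * t) (by positivity)
    linarith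
  · have h1 : 0 < s / t := by positivity
    have := hQ.2 (mem_Ici.2 (le_refl (0 : ℝ))) ht ht0.ne h2 h1 (by ring)
    simp only [smul_eq_mul, mul_zero, zero_add, hz, div_mul_cancel₀ s ht0.ne'] at this
    have h3 : 0 ≤ (1 - s / t) * Q t := mul_nonneg h2.le (h0 t ht)
    linarith

lemma norm_half_add_le (a b : E) : ‖(1 / 2 : ℝ) • (a + b)‖ ≤ (1 / 2) * ‖a‖ + (1 / 2) * ‖b‖ := by
  rw [norm_smul]
  have := norm_add_le a b
  norm_num
  linarith

lemma strictConvexOn_norm_half_add_le {Q : ℝ → ℝ} (hQ : StrictConvexOn ℝ (Ici 0) Q)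
    (h0 : ∀ t, 0 ≤ t → 0 ≤ Q t) (hz : Q 0 = 0) (a b : E) :
    Q ‖(1 / 2 : ℝ) • (a + b)‖ ≤ (1 / 2) * Q ‖a‖ + (1 / 2) * Q ‖b‖ :=
  ((strictMonoOn_of_strictConvexOn hQ h0 hz).monotoneOn (norm_nonneg _)
    (show 0 ≤ (1 / 2) * ‖a‖ + (1 / 2) * ‖b‖ by positivity) (norm_half_add_le a b)).trans
    (hQ.convexOn.2 (norm_nonneg a) (norm_nonneg b) (by norm_num) (by norm_num) (by norm_num))

/-- When the norms differ, strictness comes from `Q`. When they agree, it comes from the space: the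
midpoint of distinct vectors of equal norm is strictly shorter, and `Q` is strictly increasing. -/
lemma strictConvexOn_norm_half_add_lt [StrictConvexSpace ℝ E] {Q : ℝ → ℝ}
    (hQ : StrictConvexOn ℝ (Ici 0) Q)
    (h0 : ∀ t, 0 ≤ t → 0 ≤ Q t) (hz : Q 0 = 0) {a b : E} (hab : a ≠ b) :
    Q ‖(1 / 2 : ℝ) • (a + b)‖ < (1 / 2) * Q ‖a‖ + (1 / 2) * Q ‖b‖ := by
  have hm := strictMonoOn_of_strictConvexOn hQ h0 hz
  by_cases h : ‖a‖ = ‖b‖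
  · have h1 : ‖(1 / 2 : ℝ) • a + (1 / 2 : ℝ) • b‖ < ‖a‖ :=
      norm_combo_lt_of_ne le_rfl h.symm.le hab (by norm_num) (by norm_num) (by norm_num)
    rw [← smul_add] at h1
    have := hm (norm_nonneg _) (norm_nonneg _) h1
    rw [← h]
    linarith
  · exact lt_of_le_of_lt (hm.monotoneOn (norm_nonneg _)
      (show 0 ≤ (1 / 2) * ‖a‖ + (1 / 2) * ‖b‖ by positivity) (norm_half_add_le a b))
      (hQ.2 (norm_nonneg a) (norm_nonneg b) h (by norm_num) (by norm_num) (by norm_num))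

/-- Quantitative convexity of `‖·‖ ^ m`. -/
lemma exists_norm_sub_rpow_le [ProperSpace E] [StrictConvexSpace ℝ E] {m : ℝ} (hm : 1 < m)
    {ε : ℝ} (hε : 0 < ε) : ∃ C : ℝ, 0 < C ∧ ∀ a b : E,
      ‖a - b‖ ^ m ≤ ε * (‖a‖ ^ m + ‖b‖ ^ m) +
        C * ((1 / 2) * ‖a‖ ^ m + (1 / 2) * ‖b‖ ^ m - ‖(1 / 2 : ℝ) • (a + b)‖ ^ m) := by
  have hm0 : 0 < m := by linarith
  have hsc : StrictConvexOn ℝ (Ici 0) fun t : ℝ => t ^ m := strictConvexOn_rpow hm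
  have hnn : ∀ t : ℝ, 0 ≤ t → 0 ≤ t ^ m := fun t ht => Real.rpow_nonneg ht m
  have hz : (0 : ℝ) ^ m = 0 := Real.zero_rpow hm0.ne'
  set h : E × E → ℝ := fun x =>
    (1 / 2) * ‖x.1‖ ^ m + (1 / 2) * ‖x.2‖ ^ m - ‖(1 / 2 : ℝ) • (x.1 + x.2)‖ ^ m with hh
  have hnorm : Continuous fun z : E => ‖z‖ ^ m :=
    continuous_norm.rpow_const fun _ => Or.inr hm0.le
  have hcont : Continuous h := by
    have h1 := hnorm.comp (continuous_fst (X := E) (Y := E))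
    have h2 := hnorm.comp (continuous_snd (X := E) (Y := E))
    have h3 := hnorm.comp ((continuous_fst (X := E) (Y := E)).add
      continuous_snd |>.const_smul (1 / 2 : ℝ))
    exact ((h1.const_mul _).add (h2.const_mul _)).sub h3
  -- All terms are homogeneous of degree `m`, so it suffices to treat normalized pairs. Those too
  -- far apart for the `ε` term alone to suffice form a compact set, on which the convexity defect
  -- `h` has a positive minimum `δ`.
  set K : Set (E × E) := {x | ‖x.1‖ ^ m + ‖x.2‖ ^ m = 1 ∧ ε ≤ ‖x.1 - x.2‖ ^ m} with hK
  have hKc : IsCompact K := by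
    refine Metric.isCompact_of_isClosed_isBounded ?_ ?_
    · exact (isClosed_eq ((hnorm.comp continuous_fst).add (hnorm.comp continuous_snd))
        continuous_const).inter
        (isClosed_le continuous_const (hnorm.comp (continuous_fst.sub continuous_snd)))
    · refine (Metric.isBounded_closedBall (x := (0 : E × E)) (r := 1)).subset ?_
      rintro ⟨a, b⟩ ⟨h1, -⟩
      simp only at h1
      rw [mem_closedBall_zero_iff, Prod.norm_def]
      have ha := hnn _ (norm_nonneg a)
      have hb := hnn _ (norm_nonneg b)
      refine max_le ?_ ?_
      · exact (Real.rpow_le_rpow_iff (norm_nonneg a) zero_le_one hm0).1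
          (by rw [Real.one_rpow]; linarith)
      · exact (Real.rpow_le_rpow_iff (norm_nonneg b) zero_le_one hm0).1
          (by rw [Real.one_rpow]; linarith)
  obtain ⟨δ, hδ, hδK⟩ : ∃ δ : ℝ, 0 < δ ∧ ∀ x ∈ K, δ ≤ h x := by
    rcases K.eq_empty_or_nonempty with he | hne
    · exact ⟨1, one_pos, by simp [he]⟩
    · obtain ⟨x, hx, hmin⟩ := hKc.exists_isMinOn hne hcont.continuousOn
      refine ⟨h x, ?_, fun y hy => hmin hy⟩
      have hne : x.1 ≠ x.2 := by
        intro heq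
        have := hx.2
        rw [heq, sub_self, norm_zero, hz] at this
        linarith
      exact sub_pos.2 (strictConvexOn_norm_half_add_lt hsc hnn hz hne)
  -- For separated pairs, `‖a - b‖ ^ m ≤ 2 ^ m * s` and `δ * s ≤ h (a, b)` with `s = ‖a‖ ^ m + ‖b‖ ^
  -- m`.
  refine ⟨2 ^ m / δ, by positivity, fun a b => ?_⟩
  have hab : 0 ≤ h (a, b) := sub_nonneg.2 (strictConvexOn_norm_half_add_le hsc hnn hz a b)
  change _ ≤ _ + _ * h (a, b)
  have ha := hnn _ (norm_nonneg a)
  have hb := hnn _ (norm_nonneg b)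
  set s := ‖a‖ ^ m + ‖b‖ ^ m with hs
  by_cases hc : ‖a - b‖ ^ m ≤ ε * s
  · have : 0 ≤ 2 ^ m / δ * h (a, b) := by positivity
    linarith
  push Not at hc
  have hs0 : 0 < s := by
    rcases (add_nonneg ha hb).eq_or_lt with h0 | h0
    · have ea : ‖a‖ ^ m = 0 := by linarith
      have eb : ‖b‖ ^ m = 0 := by linarith
      rw [Real.rpow_eq_zero (norm_nonneg _) hm0.ne'] at ea eb
      rw [norm_eq_zero] at ea eb
      rw [← hs] at h0
      simp [ea, eb, ← h0, hz] at hc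
    · exact h0
  set t := s ^ m⁻¹ with ht
  have ht0 : 0 < t := by positivity
  have htm : t ^ m = s := by rw [ht, ← Real.rpow_mul hs0.le, inv_mul_cancel₀ hm0.ne', Real.rpow_one]
  have hsm : ∀ z : E, ‖t⁻¹ • z‖ ^ m = s⁻¹ * ‖z‖ ^ m := fun z => by
    rw [norm_smul, Real.mul_rpow (norm_nonneg _) (norm_nonneg _), norm_inv,
      Real.norm_of_nonneg ht0.le, Real.inv_rpow ht0.le, htm]
  have hmem : (t⁻¹ • a, t⁻¹ • b) ∈ K := by
    refine ⟨?_, ?_⟩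
    · simp only [hsm]
      rw [← mul_add, ← hs, inv_mul_cancel₀ hs0.ne']
    · simp only [← smul_sub, hsm]
      rw [le_inv_mul_iff₀ hs0]
      linarith
  have h1 := hδK _ hmem
  have h2 : h (t⁻¹ • a, t⁻¹ • b) = s⁻¹ * h (a, b) := by
    simp only [hh]
    rw [← smul_add, smul_comm (1 / 2 : ℝ), hsm, hsm, hsm]
    ring
  rw [h2, le_inv_mul_iff₀ hs0] at h1
  have hle : ∀ z : E, ‖z‖ ^ m ≤ s → ‖z‖ ≤ t := fun z hz =>
    (Real.rpow_le_rpow_iff (norm_nonneg z) ht0.le hm0).1 (by rwa [htm])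
  have h3 : ‖a - b‖ ^ m ≤ 2 ^ m * s := by
    rw [← htm, ← Real.mul_rpow (by norm_num) ht0.le]
    refine Real.rpow_le_rpow (norm_nonneg _) ?_ hm0.le
    have := norm_sub_le a b
    have := hle a (by linarith)
    have := hle b (by linarith)
    linarith
  have h4 : 2 ^ m * s ≤ 2 ^ m / δ * h (a, b) := by
    rw [div_mul_eq_mul_div, le_div_iff₀ hδ, mul_assoc]
    exact mul_le_mul_of_nonneg_left h1 (by positivity)
  have : 0 ≤ ε * s := by positivity
  linarith

end Convex

/-! ### Uniform convexity of `L^m` -/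

section Lp

variable {α : Type*} [MeasurableSpace α] {μ : Measure α} {E : Type*} [NormedAddCommGroup E]

lemma Lp_norm_rpow {m : ℝ} (hm : 1 < m) (f : Lp E (ENNReal.ofReal m) μ) :
    ‖f‖ ^ m = ∫ x, ‖f x‖ ^ m ∂μ := by
  have hm0 : 0 < m := by linarith
  have hne : ENNReal.ofReal m ≠ 0 := by simpa using hm0
  rw [Lp.norm_def, (Lp.memLp f).eLpNorm_eq_integral_rpow_norm hne ENNReal.ofReal_ne_top,
    ENNReal.toReal_ofReal hm0.le, ENNReal.toReal_ofReal (by positivity), ← Real.rpow_mul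
    (by positivity), inv_mul_cancel₀ hm0.ne', Real.rpow_one]

lemma Lp_integrable_rpow {m : ℝ} (hm : 1 < m) (f : Lp E (ENNReal.ofReal m) μ) :
    Integrable (fun x => ‖f x‖ ^ m) μ := by
  have hm0 : 0 < m := by linarith
  have := (Lp.memLp f).integrable_norm_rpow (by simpa using hm0) ENNReal.ofReal_ne_top
  rwa [ENNReal.toReal_ofReal hm0.le] at this

variable [NormedSpace ℝ E]

/-- Integrating the pointwise inequality gives uniform convexity of `L^m` for every `m > 1` at once,
with no distinction between `m < 2` and `m ≥ 2`. -/
lemma Lp_exists_norm_sub_rpow_le [ProperSpace E] [StrictConvexSpace ℝ E] {m : ℝ} (hm : 1 < m)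
    {ε : ℝ} (hε : 0 < ε) : ∃ C : ℝ, 0 < C ∧ ∀ f g : Lp E (ENNReal.ofReal m) μ,
      ‖f - g‖ ^ m ≤ ε * (‖f‖ ^ m + ‖g‖ ^ m) +
        C * ((1 / 2) * ‖f‖ ^ m + (1 / 2) * ‖g‖ ^ m - ‖(1 / 2 : ℝ) • (f + g)‖ ^ m) := by
  obtain ⟨C, hC, h⟩ := exists_norm_sub_rpow_le (E := E) hm hε
  refine ⟨C, hC, fun f g => ?_⟩
  have If := Lp_integrable_rpow hm f
  have Ig := Lp_integrable_rpow hm g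
  have Ih := Lp_integrable_rpow hm ((1 / 2 : ℝ) • (f + g))
  have I1 : Integrable (fun x => ε * (‖f x‖ ^ m + ‖g x‖ ^ m)) μ := (If.add Ig).const_mul _
  have I2 : Integrable (fun x => (1 / 2) * ‖f x‖ ^ m + (1 / 2) * ‖g x‖ ^ m) μ :=
    (If.const_mul _).add (Ig.const_mul _)
  have I3 : Integrable (fun x => C * ((1 / 2) * ‖f x‖ ^ m + (1 / 2) * ‖g x‖ ^ m
      - ‖((1 / 2 : ℝ) • (f + g) : Lp E (ENNReal.ofReal m) μ) x‖ ^ m)) μ :=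
    (I2.sub Ih).const_mul _
  simp only [Lp_norm_rpow hm]
  rw [← integral_add If Ig, ← integral_const_mul, ← integral_const_mul, ← integral_const_mul,
    ← integral_add (If.const_mul _) (Ig.const_mul _),
    ← integral_sub I2 Ih, ← integral_const_mul, ← integral_add I1 I3]
  refine integral_mono_ae (Lp_integrable_rpow hm (f - g)) (I1.add I3) ?_
  filter_upwards [Lp.coeFn_sub f g, Lp.coeFn_smul (1 / 2 : ℝ) (f + g), Lp.coeFn_add f g]
    with x h1 h2 h3
  simp only [Pi.add_apply, Pi.sub_apply, h1, h2, Pi.smul_apply, h3]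
  exact h _ _

/-- In a uniformly convex space, nested bounded closed convex sets have a common point. -/
lemma nonempty_iInter_of_midpoint_convex {X : Type*} [NormedAddCommGroup X] [NormedSpace ℝ X]
    [CompleteSpace X] {m : ℝ} (hm : 0 < m)
    (hX : ∀ ε : ℝ, 0 < ε → ∃ C : ℝ, 0 < C ∧ ∀ x y : X, ‖x - y‖ ^ m ≤ ε * (‖x‖ ^ m + ‖y‖ ^ m) +
        C * ((1 / 2) * ‖x‖ ^ m + (1 / 2) * ‖y‖ ^ m - ‖(1 / 2 : ℝ) • (x + y)‖ ^ m))
    {S : ℕ → Set X} (hanti : Antitone S) (hne : ∀ k, (S k).Nonempty) (hcl : ∀ k, IsClosed (S k))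
    (hconv : ∀ k, ∀ x ∈ S k, ∀ y ∈ S k, (1 / 2 : ℝ) • (x + y) ∈ S k)
    {R : ℝ} (hR : ∀ x ∈ S 0, ‖x‖ ≤ R) : (⋂ k, S k).Nonempty := by
  set F : X → ℝ := fun x => ‖x‖ ^ m with hF
  have hF0 : ∀ x, 0 ≤ F x := fun x => Real.rpow_nonneg (norm_nonneg x) m
  have hbdd : ∀ k, BddBelow (F '' S k) := fun k => ⟨0, by rintro _ ⟨x, -, rfl⟩; exact hF0 x⟩
  -- As in the projection theorem, almost shortest elements of the sets `S k` will form a Cauchy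
  -- sequence; the infima `d k` increase to a finite limit `l`.
  set d : ℕ → ℝ := fun k => sInf (F '' S k) with hd
  have hdle : ∀ k, ∀ x ∈ S k, d k ≤ F x := fun k x hx => csInf_le (hbdd k) ⟨x, hx, rfl⟩
  have hdmono : Monotone d := fun k l hkl =>
    csInf_le_csInf (hbdd k) ((hne l).image F) (image_mono (hanti hkl))
  have hdR : ∀ k, d k ≤ R ^ m := fun k => by
    obtain ⟨x, hx⟩ := hne k
    exact (hdle k x hx).trans
      (Real.rpow_le_rpow (norm_nonneg _) (hR x (hanti (Nat.zero_le k) hx)) hm.le)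
  have hbd : BddAbove (range d) := ⟨R ^ m, by rintro _ ⟨k, rfl⟩; exact hdR k⟩
  set l := ⨆ k, d k
  have hdl : ∀ k, d k ≤ l := fun k => le_ciSup hbd k
  have hlim : Tendsto d atTop (𝓝 l) := tendsto_atTop_ciSup hdmono hbd
  have hl0 : 0 ≤ l := (le_csInf ((hne 0).image F)
    (by rintro _ ⟨x, -, rfl⟩; exact hF0 x)).trans (hdl 0)
  have hex : ∀ k : ℕ, ∃ x ∈ S k, F x < d k + 1 / ((k : ℝ) + 1) := fun k => by
    obtain ⟨_, ⟨x, hx, rfl⟩, h⟩ := exists_lt_of_csInf_lt ((hne k).image F)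
      (show sInf (F '' S k) < d k + 1 / ((k : ℝ) + 1) from lt_add_of_pos_right _ (by positivity))
    exact ⟨x, hx, h⟩
  choose x hxS hxF using hex
  have hone : Tendsto (fun k : ℕ => 1 / ((k : ℝ) + 1)) atTop (𝓝 0) :=
    tendsto_one_div_add_atTop_nhds_zero_nat
  -- The midpoint of `x k` and `x j` lies in `S k`, so its `F` value is at least `d k`; this bounds
  -- the convexity defect by `(l - d k) + 1 / (k + 1)`.
  have hkey : ∀ ε : ℝ, 0 < ε → ∀ C : ℝ, 0 < C → ∀ k j, k ≤ j →
      (∀ x y : X, ‖x - y‖ ^ m ≤ ε * (‖x‖ ^ m + ‖y‖ ^ m) +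
        C * ((1 / 2) * ‖x‖ ^ m + (1 / 2) * ‖y‖ ^ m - ‖(1 / 2 : ℝ) • (x + y)‖ ^ m)) →
      ‖x k - x j‖ ^ m ≤ ε * (2 * (l + 1)) + C * ((l - d k) + 1 / ((k : ℝ) + 1)) := by
    intro ε hε C hC k j hkj h
    have h1 := h (x k) (x j)
    have h2 := hxF k
    have h3 := hxF j
    have h4 := hdle k _ (hconv k _ (hxS k) _ (hanti hkj (hxS j)))
    simp only [hF] at h2 h3 h4
    have h5 : 1 / ((j : ℝ) + 1) ≤ 1 / ((k : ℝ) + 1) := by gcongr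
    have h6 : 1 / ((k : ℝ) + 1) ≤ 1 := by
      rw [div_le_one (by positivity)]
      have : (0 : ℝ) ≤ k := Nat.cast_nonneg k
      linarith
    have h7 := hdl k
    have h8 := hdl j
    refine h1.trans (add_le_add (mul_le_mul_of_nonneg_left ?_ hε.le)
      (mul_le_mul_of_nonneg_left ?_ hC.le)) <;> linarith
  have hcauchy : CauchySeq x := by
    rw [Metric.cauchySeq_iff']
    intro η hη
    have hηm : 0 < η ^ m := by positivity
    obtain ⟨C, hC, h⟩ := hX (η ^ m / (4 * (l + 1))) (by positivity)
    have hsmall : Tendsto (fun k : ℕ => C * ((l - d k) + 1 / ((k : ℝ) + 1))) atTop (𝓝 0) := by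
      have := ((tendsto_const_nhds (x := l)).sub hlim |>.add hone).const_mul C
      simpa using this
    obtain ⟨N, hN⟩ := ((tendsto_order.1 hsmall).2 (η ^ m / 2) (by positivity)).exists
    refine ⟨N, fun j hj => ?_⟩
    have h1 := hkey _ (by positivity) C hC N j hj h
    have h2 : η ^ m / (4 * (l + 1)) * (2 * (l + 1)) = η ^ m / 2 := by
      field_simp
      ring
    rw [h2] at h1
    have h3 : ‖x N - x j‖ ^ m < η ^ m := by linarith
    rw [dist_comm, dist_eq_norm]
    exact (Real.rpow_lt_rpow_iff (norm_nonneg _) hη.le hm).1 h3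
  obtain ⟨y, hy⟩ := cauchySeq_tendsto_of_complete hcauchy
  refine ⟨y, mem_iInter.2 fun k => (hcl k).mem_of_tendsto hy ?_⟩
  filter_upwards [eventually_ge_atTop k] with j hj
  exact hanti hj (hxS j)

end Lp

/-! ### Minimization of convex integral functionals over closed convex sets of `L^m` -/

section Integrand

variable {α : Type*} [MeasurableSpace α] {μ : Measure α}

/-- For a simple `r` the composition is a finite sum of measurable pieces. In general `r` is
approximated by simple functions with values in `[0, ∞)`, since `Q x` is continuous only there. -/
lemma aemeasurable_comp_of_continuousOn {Q : α → ℝ → ℝ}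
    (hQm : ∀ t : ℝ, 0 ≤ t → AEMeasurable (fun x => Q x t) μ)
    (hQc : ∀ᵐ x ∂μ, ContinuousOn (Q x) (Ici 0)) {r : α → ℝ} (hr : AEMeasurable r μ)
    (hr0 : ∀ x, 0 ≤ r x) : AEMeasurable (fun x => Q x (r x)) μ := by
  have hsimple : ∀ s : SimpleFunc α ℝ, (∀ x, 0 ≤ s x) → AEMeasurable (fun x => Q x (s x)) μ := by
    intro s hs
    have e : (fun x => Q x (s x)) =
        fun x => ∑ y ∈ s.range, (s ⁻¹' {y}).indicator (fun x => Q x y) x := by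
      funext x
      rw [Finset.sum_eq_single (s x)]
      · simp
      · intro y _ hy
        exact indicator_of_notMem (fun h => hy (by simpa using h.symm)) _
      · intro h
        exact absurd (SimpleFunc.mem_range_self s x) h
    rw [e]
    refine Finset.aemeasurable_fun_sum _ fun y hy => ?_
    obtain ⟨x, rfl⟩ := SimpleFunc.mem_range.1 hy
    exact (hQm _ (hs x)).indicator (s.measurableSet_preimage _)
  have h0 : (0 : ℝ) ∈ Ici (0 : ℝ) := mem_Ici.2 le_rfl
  set s : ℕ → SimpleFunc α ℝ := fun k =>
    SimpleFunc.approxOn (hr.mk r) hr.measurable_mk (Ici 0) 0 h0 k with hs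
  have hs0 : ∀ k x, 0 ≤ s k x := fun k x => SimpleFunc.approxOn_mem hr.measurable_mk h0 k x
  refine aemeasurable_of_tendsto_metrizable_ae atTop (fun k => hsimple (s k) (hs0 k)) ?_
  filter_upwards [hQc, hr.ae_eq_mk] with x hx hrx
  have ht : Tendsto (fun k => s k x) atTop (𝓝 (r x)) := by
    rw [hrx]
    refine SimpleFunc.tendsto_approxOn hr.measurable_mk h0 (subset_closure ?_)
    rw [← hrx]
    exact hr0 x
  exact (hx (r x) (hr0 x)).tendsto.comp
    (tendsto_nhdsWithin_iff.2 ⟨ht, Eventually.of_forall fun k => hs0 k x⟩)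

/-- A nonnegative, strictly convex Carathéodory integrand which vanishes at `0` and grows at least
like `E ^ m`. -/
structure IsCoerciveIntegrand (μ : Measure α) (Q : α → ℝ → ℝ) (m K : ℝ) : Prop where
  aemeasurable : ∀ t : ℝ, 0 ≤ t → AEMeasurable (fun x => Q x t) μ
  continuousOn : ∀ᵐ x ∂μ, ContinuousOn (Q x) (Ici 0)
  nonneg : ∀ᵐ x ∂μ, ∀ t : ℝ, 0 ≤ t → 0 ≤ Q x t
  strictConvexOn : ∀ᵐ x ∂μ, StrictConvexOn ℝ (Ici 0) (Q x)
  zero : ∀ᵐ x ∂μ, Q x 0 = 0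
  coercive : ∀ᵐ x ∂μ, ∀ t : ℝ, 0 ≤ t → t ^ m ≤ K * (1 + Q x t)

variable {E : Type*} [NormedAddCommGroup E] {Q : α → ℝ → ℝ} {m K : ℝ}

/-- The integral functional with density `Q`. -/
noncomputable def energy (μ : Measure α) (Q : α → ℝ → ℝ) (v : α → E) : ℝ≥0∞ :=
  ∫⁻ x, ENNReal.ofReal (Q x ‖v x‖) ∂μ

lemma energy_congr {v w : α → E} (h : v =ᵐ[μ] w) : energy μ Q v = energy μ Q w := by
  refine lintegral_congr_ae ?_
  filter_upwards [h] with x hx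
  rw [hx]

namespace IsCoerciveIntegrand

lemma aemeasurable_comp (hQ : IsCoerciveIntegrand μ Q m K) {v : α → E}
    (hv : AEStronglyMeasurable v μ) : AEMeasurable (fun x => Q x ‖v x‖) μ :=
  aemeasurable_comp_of_continuousOn hQ.aemeasurable hQ.continuousOn hv.norm.aemeasurable
    fun _ => norm_nonneg _

/-- A convergent sequence in `L^m` has an a.e. convergent subsequence, along which Fatou's lemma
applies. Strong closedness suffices because no weak limits are taken. -/
lemma isClosed_energy_le [Fact (1 ≤ ENNReal.ofReal m)] (hQ : IsCoerciveIntegrand μ Q m K)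
    (a : ℝ≥0∞) : IsClosed {v : Lp E (ENNReal.ofReal m) μ | energy μ Q v ≤ a} := by
  refine IsSeqClosed.isClosed fun v w hv hvw => ?_
  obtain ⟨ns, -, hns⟩ := (tendstoInMeasure_of_tendsto_Lp hvw).exists_seq_tendsto_ae
  have hlim : ∀ᵐ x ∂μ, liminf (fun k => ENNReal.ofReal (Q x ‖v (ns k) x‖)) atTop =
      ENNReal.ofReal (Q x ‖w x‖) := by
    filter_upwards [hQ.continuousOn, hns] with x hx hnsx
    refine Tendsto.liminf_eq ?_
    refine (ENNReal.continuous_ofReal.tendsto _).comp ?_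
    exact (hx _ (mem_Ici.2 (norm_nonneg _))).tendsto.comp
      (tendsto_nhdsWithin_iff.2 ⟨hnsx.norm, Eventually.of_forall fun k => norm_nonneg _⟩)
  calc energy μ Q w = ∫⁻ x, liminf (fun k => ENNReal.ofReal (Q x ‖v (ns k) x‖)) atTop ∂μ :=
        lintegral_congr_ae (hlim.mono fun x hx => hx.symm)
    _ ≤ liminf (fun k => energy μ Q (v (ns k))) atTop :=
        lintegral_liminf_le' fun k =>
          (hQ.aemeasurable_comp (Lp.aestronglyMeasurable (v (ns k)))).ennreal_ofReal
    _ ≤ liminf (fun _ : ℕ => a) atTop := liminf_le_liminf (Eventually.of_forall fun k => hv (ns k))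
    _ = a := liminf_const a

lemma eLpNorm_rpow_le (hm : 1 < m) (hK : 0 ≤ K) (hQ : IsCoerciveIntegrand μ Q m K) (v : α → E) :
    eLpNorm v (ENNReal.ofReal m) μ ^ m ≤ ENNReal.ofReal K * (μ univ + energy μ Q v) := by
  have hm0 : 0 < m := by linarith
  rw [eLpNorm_eq_lintegral_rpow_enorm_toReal (by simpa using hm0) ENNReal.ofReal_ne_top,
    ENNReal.toReal_ofReal hm0.le, ← ENNReal.rpow_mul, one_div, inv_mul_cancel₀ hm0.ne',
    ENNReal.rpow_one]
  calc ∫⁻ x, ‖v x‖ₑ ^ m ∂μ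
      ≤ ∫⁻ x, ENNReal.ofReal K * (1 + ENNReal.ofReal (Q x ‖v x‖)) ∂μ := by
        refine lintegral_mono_ae ?_
        filter_upwards [hQ.nonneg, hQ.coercive] with x h0 hx
        rw [← ofReal_norm, ENNReal.ofReal_rpow_of_nonneg (norm_nonneg _) hm0.le,
          ← ENNReal.ofReal_one, ← ENNReal.ofReal_add zero_le_one (h0 _ (norm_nonneg _)),
          ← ENNReal.ofReal_mul hK]
        exact ENNReal.ofReal_le_ofReal (hx _ (norm_nonneg _))
    _ = ENNReal.ofReal K * (μ univ + energy μ Q v) := by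
        rw [lintegral_const_mul' _ _ ENNReal.ofReal_ne_top, lintegral_add_left measurable_const]
        simp [energy]

lemma lintegral_half (hQ : IsCoerciveIntegrand μ Q m K) (v w : Lp E (ENNReal.ofReal m) μ) :
    ∫⁻ x, ENNReal.ofReal ((1 / 2) * Q x ‖v x‖ + (1 / 2) * Q x ‖w x‖) ∂μ =
      ENNReal.ofReal (1 / 2) * (energy μ Q v + energy μ Q w) := by
  have e : ∀ᵐ x ∂μ, ENNReal.ofReal ((1 / 2) * Q x ‖v x‖ + (1 / 2) * Q x ‖w x‖) =
      ENNReal.ofReal (1 / 2) * (ENNReal.ofReal (Q x ‖v x‖) + ENNReal.ofReal (Q x ‖w x‖)) := by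
    filter_upwards [hQ.nonneg] with x h0
    have h1 := h0 _ (norm_nonneg (v x))
    have h2 := h0 _ (norm_nonneg (w x))
    rw [← ENNReal.ofReal_add h1 h2, ← ENNReal.ofReal_mul (by norm_num), mul_add]
  rw [lintegral_congr_ae e, lintegral_const_mul' _ _ ENNReal.ofReal_ne_top,
    lintegral_add_left' (hQ.aemeasurable_comp (Lp.aestronglyMeasurable v)).ennreal_ofReal]
  rfl

variable [NormedSpace ℝ E]

lemma ae_half_le (hQ : IsCoerciveIntegrand μ Q m K) (v w : Lp E (ENNReal.ofReal m) μ) :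
    ∀ᵐ x ∂μ, ENNReal.ofReal (Q x ‖((1 / 2 : ℝ) • (v + w) : Lp E (ENNReal.ofReal m) μ) x‖) ≤
      ENNReal.ofReal ((1 / 2) * Q x ‖v x‖ + (1 / 2) * Q x ‖w x‖) := by
  filter_upwards [Lp.coeFn_smul (1 / 2 : ℝ) (v + w), Lp.coeFn_add v w, hQ.nonneg,
    hQ.strictConvexOn, hQ.zero] with x h1 h2 h3 h4 h5
  rw [h1, Pi.smul_apply, h2]
  exact ENNReal.ofReal_le_ofReal (strictConvexOn_norm_half_add_le h4 h3 h5 _ _)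

lemma energy_half_le (hQ : IsCoerciveIntegrand μ Q m K) {v w : Lp E (ENNReal.ofReal m) μ}
    {a : ℝ≥0∞} (hv : energy μ Q v ≤ a) (hw : energy μ Q w ≤ a) :
    energy μ Q ((1 / 2 : ℝ) • (v + w) : Lp E (ENNReal.ofReal m) μ) ≤ a := by
  refine (lintegral_mono_ae (hQ.ae_half_le v w)).trans ?_
  rw [hQ.lintegral_half]
  calc ENNReal.ofReal (1 / 2) * (energy μ Q v + energy μ Q w)
      ≤ ENNReal.ofReal (1 / 2) * (a + a) := by gcongr
    _ = a := by
      rw [← two_mul, ← mul_assoc, ← ENNReal.ofReal_ofNat, ← ENNReal.ofReal_mul (by norm_num)]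
      norm_num

/-- The pointwise midpoint inequality becomes an equality after integration. As the integrals are
finite, it is then an equality a.e., whereas it is strict wherever `v x ≠ w x`. -/
lemma eq_of_energy_half_ge [StrictConvexSpace ℝ E] (hQ : IsCoerciveIntegrand μ Q m K)
    {v w : Lp E (ENNReal.ofReal m) μ} {a : ℝ≥0∞} (ha : a ≠ ⊤) (hv : energy μ Q v ≤ a)
    (hw : energy μ Q w ≤ a)
    (hvw : a ≤ energy μ Q ((1 / 2 : ℝ) • (v + w) : Lp E (ENNReal.ofReal m) μ)) : v = w := by
  have hle : ENNReal.ofReal (1 / 2) * (energy μ Q v + energy μ Q w) ≤ a := by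
    calc ENNReal.ofReal (1 / 2) * (energy μ Q v + energy μ Q w)
        ≤ ENNReal.ofReal (1 / 2) * (a + a) := by gcongr
      _ = a := by
        rw [← two_mul, ← mul_assoc, ← ENNReal.ofReal_ofNat, ← ENNReal.ofReal_mul (by norm_num)]
        norm_num
  have hmv := hQ.aemeasurable_comp (Lp.aestronglyMeasurable v)
  have hmw := hQ.aemeasurable_comp (Lp.aestronglyMeasurable w)
  have heq := ae_eq_of_ae_le_of_lintegral_le (hQ.ae_half_le v w)
    (ne_top_of_le_ne_top ha (hQ.energy_half_le hv hw))
    ((hmv.const_mul _).add (hmw.const_mul _)).ennreal_ofReal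
    (by rw [hQ.lintegral_half]; exact hle.trans hvw)
  refine Lp.ext ?_
  filter_upwards [heq, Lp.coeFn_smul (1 / 2 : ℝ) (v + w), Lp.coeFn_add v w, hQ.nonneg,
    hQ.strictConvexOn, hQ.zero] with x h h1 h2 h3 h4 h5
  by_contra hne
  rw [h1, Pi.smul_apply, h2] at h
  have hlt := strictConvexOn_norm_half_add_lt h4 h3 h5 hne
  have h6 := h3 _ (norm_nonneg ((1 / 2 : ℝ) • (v x + w x)))
  exact absurd h ((ENNReal.ofReal_lt_ofReal_iff (h6.trans_lt hlt)).2 hlt).ne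

/-- The direct method: a coercive strictly convex integral functional has exactly one minimizer on
a closed convex subset of `L^m` on which it is somewhere finite. -/
theorem existsUnique_isMinOn [IsFiniteMeasure μ] [ProperSpace E] [StrictConvexSpace ℝ E]
    [Fact (1 ≤ ENNReal.ofReal m)] (hm : 1 < m) (hK : 0 ≤ K) (hQ : IsCoerciveIntegrand μ Q m K)
    {S : Set (Lp E (ENNReal.ofReal m) μ)} (hcl : IsClosed S) (hconv : Convex ℝ S)
    (hfin : ∃ v ∈ S, energy μ Q v ≠ ⊤) :
    ∃! v, v ∈ S ∧ ∀ w ∈ S, energy μ Q v ≤ energy μ Q w := by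
  have hm0 : 0 < m := by linarith
  have hmid : ∀ v ∈ S, ∀ w ∈ S, (1 / 2 : ℝ) • (v + w) ∈ S := fun v hv w hw => by
    rw [smul_add]
    exact hconv hv hw (by norm_num) (by norm_num) (by norm_num)
  set I : ℝ≥0∞ := ⨅ v ∈ S, energy μ Q v with hI
  have hIle : ∀ v ∈ S, I ≤ energy μ Q v := fun v hv => iInf₂_le v hv
  obtain ⟨v₀, hv₀, hv₀'⟩ := hfin
  have hItop : I < ⊤ := (hIle v₀ hv₀).trans_lt hv₀'.lt_top
  -- Levels strictly above `I` give nonempty sublevel sets; a common point of all of them is a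
  -- minimizer. Finiteness of `a 0` bounds these sets through coercivity.
  obtain ⟨a, ha_anti, ha_mem, ha_lim⟩ := exists_seq_strictAnti_tendsto' hItop
  obtain ⟨v, hv⟩ := nonempty_iInter_of_midpoint_convex (X := Lp E (ENNReal.ofReal m) μ) hm0
    (fun ε hε => Lp_exists_norm_sub_rpow_le hm hε)
    (S := fun k => S ∩ {v | energy μ Q v ≤ a k})
    (fun k l hkl v hv => ⟨hv.1, hv.2.trans (ha_anti.antitone hkl)⟩)
    (fun k => by
      have hlt := (ha_mem k).1
      simp only [hI, iInf_lt_iff, exists_prop] at hlt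
      obtain ⟨v, hvS, hv⟩ := hlt
      exact ⟨v, hvS, hv.le⟩)
    (fun k => hcl.inter (hQ.isClosed_energy_le (a k)))
    (fun k v hv w hw => ⟨hmid v hv.1 w hw.1, hQ.energy_half_le hv.2 hw.2⟩)
    (R := ((ENNReal.ofReal K * (μ univ + a 0)) ^ m⁻¹).toReal)
    (fun v hv => by
      rw [Lp.norm_def]
      refine ENNReal.toReal_mono ?_ ?_
      · exact ENNReal.rpow_ne_top_of_nonneg (by positivity) (ENNReal.mul_ne_top ENNReal.ofReal_ne_top
          (ENNReal.add_ne_top.2 ⟨measure_ne_top _ _, (ha_mem 0).2.ne⟩))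
      · rw [ENNReal.le_rpow_inv_iff hm0]
        refine (hQ.eLpNorm_rpow_le hm hK v).trans ?_
        have := hv.2
        gcongr
        exact this)
  have hvS : v ∈ S := (mem_iInter.1 hv 0).1
  have hvI : energy μ Q v ≤ I := ge_of_tendsto' ha_lim fun k => (mem_iInter.1 hv k).2
  refine ⟨v, ⟨hvS, fun w hw => hvI.trans (hIle w hw)⟩, fun w hw => ?_⟩
  exact hQ.eq_of_energy_half_ge hItop.ne ((hw.2 v hvS).trans hvI) hvI
    (hIle _ (hmid w hw.1 v hvS))

end IsCoerciveIntegrand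

end Integrand

/-! ### The Poincaré inequality for test functions -/

section Poincare

variable {n : ℕ} {Ω : Set (Rn n)}

lemma support_gradient_subset (φ : Rn n → ℝ) :
    Function.support (gradient φ) ⊆ tsupport φ := by
  intro x hx
  refine support_fderiv_subset ℝ (f := φ) ?_
  intro h
  exact hx (by simp [gradient, h])

lemma norm_gradient (φ : Rn n → ℝ) (x : Rn n) : ‖gradient φ x‖ = ‖fderiv ℝ φ x‖ := by
  simp [gradient]

/-- A test function is controlled by the integral of its gradient along a direction. -/
lemma enorm_rpow_le_of_isTestC1 {φ : Rn n → ℝ} (hφ : IsTestC1 Ω φ) {e : Rn n} (he : ‖e‖ = 1)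
    {R : ℝ} (hR : 0 < R) (hΩ : Ω ⊆ Metric.ball 0 R) {s : ℝ} (hs : 1 < s) {x : Rn n} (hx : x ∈ Ω) :
    ‖φ x‖ₑ ^ s ≤ ENNReal.ofReal (2 * R) ^ (s - 1) *
      ∫⁻ t in Ioc 0 (2 * R), ‖gradient φ (x + t • e)‖ₑ ^ s := by
  have hs0 : 0 < s := by linarith
  -- Two points of a ball of radius `R` are less than `2 * R` apart, so the segment of this length
  -- starting at `x` ends outside `Ω`.
  have hend : φ (x + (2 * R) • e) = 0 := by
    by_contra h
    have h1 := hΩ (hφ.support (subset_tsupport φ h))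
    have h2 := hΩ hx
    rw [mem_ball_zero_iff] at h1 h2
    have h3 : ‖(2 * R) • e‖ = 2 * R := by
      rw [norm_smul, he, Real.norm_of_nonneg (by positivity), mul_one]
    have h4 := norm_sub_le (x + (2 * R) • e) x
    rw [add_sub_cancel_left, h3] at h4
    linarith
  have hline : ∀ t : ℝ, HasDerivAt (fun t : ℝ => x + t • e) e t := fun t => by
    simpa using ((hasDerivAt_id t).smul_const e).const_add x
  have hcl : Continuous fun t : ℝ => x + t • e := by fun_prop
  have hderiv : ∀ t : ℝ, HasDerivAt (fun t : ℝ => φ (x + t • e)) (fderiv ℝ φ (x + t • e) e) t :=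
    fun t => ((hφ.contDiff.differentiable (by simp) _).hasFDerivAt).comp_hasDerivAt t (hline t)
  have hcont : Continuous fun t : ℝ => fderiv ℝ φ (x + t • e) e :=
    ((hφ.contDiff.continuous_fderiv (by simp)).comp hcl).clm_apply continuous_const
  have hint := intervalIntegral.integral_eq_sub_of_hasDerivAt (a := 0) (b := 2 * R)
    (fun t _ => hderiv t) (hcont.intervalIntegrable _ _)
  rw [hend, zero_smul, add_zero, zero_sub, intervalIntegral.integral_of_le (by positivity)] at hint
  have hcg : Continuous fun t : ℝ => gradient φ (x + t • e) :=
    (continuous_gradient hφ.contDiff).comp hcl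
  have h1 : ‖φ x‖ₑ ≤ eLpNorm (fun t : ℝ => gradient φ (x + t • e)) 1
      (volume.restrict (Ioc 0 (2 * R))) := by
    rw [eLpNorm_one_eq_lintegral_enorm, ← enorm_neg, ← hint]
    refine (enorm_integral_le_lintegral_enorm _).trans (lintegral_mono fun t => ?_)
    rw [enorm_le_iff_norm_le, norm_gradient]
    simpa [he] using (fderiv ℝ φ (x + t • e)).le_opNorm e
  -- Hölder's inequality on an interval of length `2 * R`; raising to the power `s` produces the
  -- factor `(2 * R) ^ (s - 1)`.
  have h2 := eLpNorm_le_eLpNorm_mul_rpow_measure_univ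
    (μ := volume.restrict (Ioc 0 (2 * R))) (p := 1) (q := ENNReal.ofReal s)
    (by rw [← ENNReal.ofReal_one]; exact ENNReal.ofReal_le_ofReal hs.le)
    hcg.aestronglyMeasurable
  have h3 := ENNReal.rpow_le_rpow (h1.trans h2) hs0.le
  refine h3.trans_eq ?_
  rw [ENNReal.mul_rpow_of_nonneg _ _ hs0.le, mul_comm, Measure.restrict_apply_univ,
    Real.volume_Ioc, sub_zero, ← ENNReal.rpow_mul,
    eLpNorm_eq_lintegral_rpow_enorm_toReal (by simpa using hs0) ENNReal.ofReal_ne_top,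
    ENNReal.toReal_ofReal hs0.le, ← ENNReal.rpow_mul, one_div_mul_cancel hs0.ne',
    ENNReal.rpow_one]
  congr 2
  simp only [ENNReal.toReal_one]
  field_simp

/-- Integrate the bound along lines over `x` and exchange the integrals: by translation invariance
the inner integral does not depend on `t`, and the length of the interval supplies the last factor
`2 * R`. -/
lemma lintegral_rpow_le_of_isTestC1 {φ : Rn n → ℝ} (hφ : IsTestC1 Ω φ) {e : Rn n} (he : ‖e‖ = 1)
    {R : ℝ} (hR : 0 < R) (hΩ : Ω ⊆ Metric.ball 0 R) {s : ℝ} (hs : 1 < s) :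
    ∫⁻ x in Ω, ‖φ x‖ₑ ^ s ≤ ENNReal.ofReal (2 * R) ^ s * ∫⁻ x in Ω, ‖gradient φ x‖ₑ ^ s := by
  have hs0 : 0 < s := by linarith
  have hcg := continuous_gradient hφ.contDiff
  have hmg : Measurable fun y : Rn n => ‖gradient φ y‖ₑ ^ s :=
    (hcg.measurable.enorm).pow_const s
  have hsupp : ∫⁻ x, ‖gradient φ x‖ₑ ^ s = ∫⁻ x in Ω, ‖gradient φ x‖ₑ ^ s := by
    refine (setLIntegral_eq_of_support_subset ?_).symm
    intro x hx
    refine hφ.support (support_gradient_subset φ fun h => hx ?_)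
    simp [h, hs0]
  have hjoint : Measurable fun z : Rn n × ℝ => ‖gradient φ (z.1 + z.2 • e)‖ₑ ^ s :=
    hmg.comp (by fun_prop : Measurable fun z : Rn n × ℝ => z.1 + z.2 • e)
  have hR2 : ENNReal.ofReal (2 * R) ≠ 0 := by simpa using hR
  have key : ∫⁻ x in Ω, ‖φ x‖ₑ ^ s ≤ ∫⁻ x, ENNReal.ofReal (2 * R) ^ (s - 1) *
      ∫⁻ t in Ioc 0 (2 * R), ‖gradient φ (x + t • e)‖ₑ ^ s := by
    rw [setLIntegral_eq_of_support_subset]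
    · refine lintegral_mono fun x => ?_
      by_cases hx : x ∈ Ω
      · exact enorm_rpow_le_of_isTestC1 hφ he hR hΩ hs hx
      · have : φ x = 0 := by
          by_contra h
          exact hx (hφ.support (subset_tsupport φ h))
        simp [this, hs0]
    · intro x hx
      refine hφ.support (subset_tsupport φ fun h => hx ?_)
      simp [h, hs0]
  refine key.trans_eq ?_
  rw [lintegral_const_mul' _ _ (ENNReal.rpow_ne_top_of_nonneg (by linarith) ENNReal.ofReal_ne_top),
    lintegral_lintegral_swap hjoint.aemeasurable]
  have hinner : ∀ t : ℝ, ∫⁻ x, ‖gradient φ (x + t • e)‖ₑ ^ s = ∫⁻ x in Ω, ‖gradient φ x‖ₑ ^ s :=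
    fun t => by
      rw [← hsupp]
      exact lintegral_add_right_eq_self (fun y => ‖gradient φ y‖ₑ ^ s) (t • e)
  simp only [hinner, lintegral_const, Measure.restrict_apply_univ, Real.volume_Ioc, sub_zero]
  have : ENNReal.ofReal (2 * R) ^ s = ENNReal.ofReal (2 * R) ^ (s - 1) * ENNReal.ofReal (2 * R) := by
    conv_rhs => rw [← ENNReal.rpow_one (ENNReal.ofReal (2 * R)), ← ENNReal.rpow_mul, one_mul,
      ← ENNReal.rpow_add _ _ hR2 ENNReal.ofReal_ne_top, sub_add_cancel]
  rw [this]
  ring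

theorem exists_eLpNorm_le_eLpNorm_gradient (hn : 0 < n) (hΩ : Bornology.IsBounded Ω) {s : ℝ}
    (hs : 1 < s) : ∃ C : ℝ≥0∞, C ≠ ⊤ ∧ ∀ φ : Rn n → ℝ, IsTestC1 Ω φ →
      eLpNorm φ (ENNReal.ofReal s) (volume.restrict Ω) ≤
        C * eLpNorm (gradient φ) (ENNReal.ofReal s) (volume.restrict Ω) := by
  have hs0 : 0 < s := by linarith
  obtain ⟨R, hR, hsub⟩ := hΩ.subset_ball_lt 0 0
  refine ⟨ENNReal.ofReal (2 * R), ENNReal.ofReal_ne_top, fun φ hφ => ?_⟩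
  have h := lintegral_rpow_le_of_isTestC1 hφ (e := EuclideanSpace.single ⟨0, hn⟩ 1) (by simp)
    hR hsub hs
  simp only [eLpNorm_eq_lintegral_rpow_enorm_toReal (p := ENNReal.ofReal s) (by simpa using hs0)
    ENNReal.ofReal_ne_top, ENNReal.toReal_ofReal hs0.le]
  refine (ENNReal.rpow_le_rpow h (z := 1 / s) (by positivity)).trans_eq ?_
  rw [ENNReal.mul_rpow_of_nonneg _ _ (by positivity), ← ENNReal.rpow_mul, mul_one_div_cancel hs0.ne',
    ENNReal.rpow_one]

end Poincare

/-! ### Weak gradients and Sobolev spaces -/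

lemma eq_zero_of_forall_le_mul {a K : ℝ≥0∞} (hK : K ≠ ⊤)
    (h : ∀ ε : ℝ≥0∞, 0 < ε → a ≤ K * ε) : a = 0 := by
  have ht : Tendsto (fun k : ℕ => K * (k : ℝ≥0∞)⁻¹) atTop (𝓝 0) := by
    simpa using ENNReal.Tendsto.const_mul ENNReal.tendsto_inv_nat_nhds_zero (Or.inr hK)
  exact le_antisymm (ge_of_tendsto' ht fun k => h _ (by simp)) zero_le

section Sobolev

variable {n : ℕ} {Ω : Set (Rn n)}

lemma setIntegral_eq_of_tsupport {F : Type*} [NormedAddCommGroup F] [NormedSpace ℝ F]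
    {φ : Rn n → ℝ} (hs : tsupport φ ⊆ Ω) {f : Rn n → F} (hf : ∀ x, φ x = 0 → f x = 0) :
    ∫ x in Ω, f x = ∫ x, f x :=
  setIntegral_eq_integral_of_forall_compl_eq_zero fun x hx => hf x (by
    by_contra h
    exact hx (hs (subset_tsupport φ h)))

lemma inner_gradient (φ : Rn n → ℝ) (x v : Rn n) : inner ℝ (gradient φ x) v = fderiv ℝ φ x v := by
  simp [gradient]

/-- The test function has compact support in `Ω`, so both integrals extend to the whole space, where
integration by parts has no boundary term. -/
lemma isWeakGradient_of_contDiff {φ : Rn n → ℝ} (hφ : ContDiff ℝ 1 φ) :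
    IsWeakGradient Ω φ (gradient φ) := by
  refine ⟨hφ.continuous.locallyIntegrable.locallyIntegrableOn Ω,
    (continuous_gradient hφ).locallyIntegrable.locallyIntegrableOn Ω, fun ψ h1 h2 h3 v => ?_⟩
  have hψ0 : ∀ x, x ∉ tsupport ψ → fderiv ℝ ψ x v = 0 := fun x hx => by
    rw [fderiv_of_notMem_tsupport ℝ hx]
    rfl
  have hcψ : Continuous fun x => fderiv ℝ ψ x v :=
    (h1.continuous_fderiv (by simp)).clm_apply continuous_const
  have hcφ : Continuous fun x => fderiv ℝ φ x v :=
    (hφ.continuous_fderiv (by simp)).clm_apply continuous_const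
  simp only [inner_gradient]
  rw [setIntegral_eq_of_tsupport h3 (f := fun x => fderiv ℝ φ x v * ψ x)
      (fun x hx => by simp [hx]),
    setIntegral_eq_integral_of_forall_compl_eq_zero
      (fun x hx => by rw [hψ0 x fun h => hx (h3 h), mul_zero])]
  refine integral_mul_fderiv_eq_neg_fderiv_mul_of_integrable ?_ ?_ ?_
    (fun x _ => hφ.differentiable (by simp) x) (fun x _ => h1.differentiable (by simp) x)
  · exact (hcφ.mul h1.continuous).integrable_of_hasCompactSupport h2.mul_left
  · exact (hφ.continuous.mul hcψ).integrable_of_hasCompactSupport (h2.fderiv_apply ℝ v).mul_left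
  · exact (hφ.continuous.mul h1.continuous).integrable_of_hasCompactSupport h2.mul_left

/-- The fundamental lemma of the calculus of variations, applied to each coordinate of `G - H`. -/
lemma IsWeakGradient.ae_eq (hΩ : IsOpen Ω) {u : Rn n → ℝ} {G H : Rn n → Rn n}
    (hG : IsWeakGradient Ω u G) (hH : IsWeakGradient Ω u H) : G =ᵐ[volume.restrict Ω] H := by
  have key : ∀ v : Rn n, ∀ᵐ x, x ∈ Ω → inner ℝ (G x - H x) v = 0 := by
    intro v
    refine hΩ.ae_eq_zero_of_integral_contDiff_smul_eq_zero
      (locallyIntegrableOn_inner (hG.2.sub hH.2) v) fun ψ h1 h2 h3 => ?_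
    rw [← setIntegral_eq_of_tsupport h3 (fun x hx => by simp [hx])]
    have e := (hG.3 ψ h1 h2 h3 v).symm.trans (hH.3 ψ h1 h2 h3 v)
    rw [neg_inj, ← sub_eq_zero, ← integral_sub
      (integrableOn_mul_of_compact (locallyIntegrableOn_inner hG.2 v) h1.continuous h2 h3)
      (integrableOn_mul_of_compact (locallyIntegrableOn_inner hH.2 v) h1.continuous h2 h3)] at e
    rw [← e]
    refine integral_congr_ae (Eventually.of_forall fun x => ?_)
    simp only [inner_sub_left, smul_eq_mul]
    ring
  have hall : ∀ᵐ x, ∀ i : Fin n, x ∈ Ω → inner ℝ (G x - H x) (EuclideanSpace.single i (1 : ℝ)) = 0 :=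
    ae_all_iff.2 fun i => key _
  rw [EventuallyEq, ae_restrict_iff' hΩ.measurableSet]
  filter_upwards [hall] with x hx hxΩ
  ext i
  have := hx i hxΩ
  simp only [EuclideanSpace.inner_single_right, one_mul] at this
  simpa [sub_eq_zero] using this

lemma weakGradient_ae_eq (hΩ : IsOpen Ω) {u : Fun Ω} {G : Rn n → Rn n}
    (hG : IsWeakGradient Ω u G) : weakGradient Ω u =ᵐ[volume.restrict Ω] G := by
  have h : ∃ G : Rn n → Rn n, IsWeakGradient Ω u G := ⟨G, hG⟩
  rw [weakGradient, dif_pos h]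
  exact h.choose_spec.ae_eq hΩ hG

lemma one_le_ofReal {s : ℝ} (hs : 1 ≤ s) : 1 ≤ ENNReal.ofReal s := by
  rw [← ENNReal.ofReal_one]
  exact ENNReal.ofReal_le_ofReal hs

lemma enorm_setIntegral_mul_le {s : ℝ} (hs : 1 ≤ s) {u f : Rn n → ℝ}
    (hu : AEStronglyMeasurable u (volume.restrict Ω)) {M : ℝ} (hM : ∀ x, ‖f x‖ ≤ M) :
    ‖∫ x in Ω, u x * f x‖ₑ ≤ eLpNorm u (ENNReal.ofReal s) (volume.restrict Ω) *
      (volume Ω ^ (1 - 1 / s) * ENNReal.ofReal M) := by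
  have h1 : eLpNorm u 1 (volume.restrict Ω) ≤ eLpNorm u (ENNReal.ofReal s) (volume.restrict Ω) *
      volume Ω ^ (1 - 1 / s) := by
    have := eLpNorm_le_eLpNorm_mul_rpow_measure_univ (μ := volume.restrict Ω) (one_le_ofReal hs) hu
    simpa [ENNReal.toReal_ofReal (zero_le_one.trans hs)] using this
  rw [← mul_assoc]
  refine (enorm_integral_le_lintegral_enorm _).trans ?_
  calc ∫⁻ x in Ω, ‖u x * f x‖ₑ ≤ ∫⁻ x in Ω, ‖u x‖ₑ * ENNReal.ofReal M := by
        refine lintegral_mono fun x => ?_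
        rw [enorm_mul]
        gcongr
        rw [← ofReal_norm]
        exact ENNReal.ofReal_le_ofReal (hM x)
    _ = eLpNorm u 1 (volume.restrict Ω) * ENNReal.ofReal M := by
        rw [lintegral_mul_const' _ _ ENNReal.ofReal_ne_top, eLpNorm_one_eq_lintegral_enorm]
    _ ≤ _ := by gcongr

lemma sobolevZero_le_sobolev {s : ℝ} : sobolevZero Ω s ≤ sobolev Ω s := by
  rintro u ⟨G, h1, h2, h3, -⟩
  exact ⟨G, h1, h2, h3⟩

variable [IsFiniteMeasure (volume.restrict Ω)]

lemma locallyIntegrableOn_of_memLp {F : Type*} [NormedAddCommGroup F] {s : ℝ} (hs : 1 ≤ s)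
    {u : Rn n → F} (hu : MemLp u (ENNReal.ofReal s) (volume.restrict Ω)) :
    LocallyIntegrableOn u Ω volume :=
  IntegrableOn.locallyIntegrableOn (hu.integrable (one_le_ofReal hs))

/-- A limit in `W^{1,s}` of `C¹` functions is weakly differentiable. -/
lemma isWeakGradient_of_approx {s : ℝ} (hs : 1 ≤ s) {u : Rn n → ℝ} {G : Rn n → Rn n}
    (hu : MemLp u (ENNReal.ofReal s) (volume.restrict Ω))
    (hG : MemLp G (ENNReal.ofReal s) (volume.restrict Ω))
    (happ : ∀ ε : ℝ≥0∞, 0 < ε → ∃ φ : Rn n → ℝ, ContDiff ℝ 1 φ ∧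
      eLpNorm (u - φ) (ENNReal.ofReal s) (volume.restrict Ω) ≤ ε ∧
      eLpNorm (G - gradient φ) (ENNReal.ofReal s) (volume.restrict Ω) ≤ ε) :
    IsWeakGradient Ω u G := by
  have hul := locallyIntegrableOn_of_memLp hs hu
  have hGl := locallyIntegrableOn_of_memLp hs hG
  refine ⟨hul, hGl, fun ψ h1 h2 h3 v => ?_⟩
  rw [← sub_eq_zero, sub_neg_eq_add, ← enorm_eq_zero]
  have hcψ : Continuous fun x => fderiv ℝ ψ x v :=
    (h1.continuous_fderiv (by simp)).clm_apply continuous_const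
  obtain ⟨M₁, hM₁⟩ := hcψ.bounded_above_of_compact_support (h2.fderiv_apply ℝ v)
  obtain ⟨M₂, hM₂⟩ := h1.continuous.bounded_above_of_compact_support h2
  set c := volume Ω ^ (1 - 1 / s) with hc
  have hc_top : c ≠ ⊤ := by
    have h : volume Ω ≠ ⊤ := by
      rw [← Measure.restrict_apply_univ]
      exact measure_ne_top _ _
    refine ENNReal.rpow_ne_top_of_nonneg ?_ h
    rw [sub_nonneg, div_le_one (by linarith)]
    exact hs
  refine eq_zero_of_forall_le_mul (K := c * ENNReal.ofReal M₁ + ‖v‖ₑ * (c * ENNReal.ofReal M₂))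
    (by finiteness) fun ε hε => ?_
  obtain ⟨φ, hφ, ha, hb⟩ := happ ε hε
  have hφw := isWeakGradient_of_contDiff (Ω := Ω) hφ
  -- The smooth `φ` satisfies the identity exactly, so subtracting it leaves only the errors `u - φ`
  -- and `G - gradient φ`, which Hölder's inequality controls.
  have e : (∫ x in Ω, u x * fderiv ℝ ψ x v) + ∫ x in Ω, inner ℝ (G x) v * ψ x =
      (∫ x in Ω, (u - φ) x * fderiv ℝ ψ x v) +
        ∫ x in Ω, inner ℝ ((G - gradient φ) x) v * ψ x := by
    have e0 := hφw.3 ψ h1 h2 h3 v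
    have e1 := integral_sub (integrable_mul_fderiv hul h1 h2 h3 v)
      (integrable_mul_fderiv hφw.1 h1 h2 h3 v)
    have e2 := integral_sub
      (integrableOn_mul_of_compact (locallyIntegrableOn_inner hGl v) h1.continuous h2 h3)
      (integrableOn_mul_of_compact (locallyIntegrableOn_inner hφw.2 v) h1.continuous h2 h3)
    simp only [Pi.sub_apply, sub_mul, inner_sub_left]
    rw [e1, e2, e0]
    ring
  rw [e, add_mul]
  have hm := hG.1.sub (continuous_gradient hφ).aestronglyMeasurable
  refine (enorm_add_le _ _).trans (add_le_add ?_ ?_)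
  · refine (enorm_setIntegral_mul_le hs (hu.1.sub hφ.continuous.aestronglyMeasurable) hM₁).trans ?_
    rw [mul_comm]
    gcongr
  · refine (enorm_setIntegral_mul_le hs (hm.inner_const) hM₂).trans ?_
    have : eLpNorm (fun x => inner ℝ ((G - gradient φ) x) v) (ENNReal.ofReal s)
        (volume.restrict Ω) ≤ ‖v‖ₑ * ε := by
      have h := eLpNorm_le_nnreal_smul_eLpNorm_of_ae_le_mul
        (f := fun x => inner ℝ ((G - gradient φ) x) v) (g := G - gradient φ) (c := ‖v‖₊)
        (μ := volume.restrict Ω)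
        (Eventually.of_forall fun x => by
          rw [mul_comm]; exact nnnorm_inner_le_nnnorm (𝕜 := ℝ) ((G - gradient φ) x) v)
        (ENNReal.ofReal s)
      refine h.trans ?_
      rw [ENNReal.smul_def, smul_eq_mul]
      gcongr
      exact le_rfl
    calc _ ≤ (‖v‖ₑ * ε) * (c * ENNReal.ofReal M₂) := by gcongr
      _ = _ := by ring

lemma sobolev_mono {s t : ℝ} (hst : s ≤ t) : sobolev Ω t ≤ sobolev Ω s := by
  rintro u ⟨G, h1, h2, h3⟩
  have h := ENNReal.ofReal_le_ofReal hst
  exact ⟨G, h1, h2.mono_exponent h, h3.mono_exponent h⟩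

/-- On a set of finite measure the `L^t` norm controls the `L^s` norm up to the factor `volume Ω ^
(1 / s - 1 / t)`, so the same test functions approximate in both spaces. -/
lemma sobolevZero_mono {s t : ℝ} (hs : 1 ≤ s) (hst : s ≤ t) :
    sobolevZero Ω t ≤ sobolevZero Ω s := by
  rintro u ⟨G, h1, h2, h3, h4⟩
  have h := ENNReal.ofReal_le_ofReal hst
  refine ⟨G, h1, h2.mono_exponent h, h3.mono_exponent h, fun ε hε => ?_⟩
  set c := volume Ω ^ (1 / s - 1 / t) with hc
  have hc_top : c ≠ ⊤ := by
    have h : volume Ω ≠ ⊤ := by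
      rw [← Measure.restrict_apply_univ]
      exact measure_ne_top _ _
    refine ENNReal.rpow_ne_top_of_nonneg ?_ h
    rw [sub_nonneg]
    exact one_div_le_one_div_of_le (by linarith) hst
  have hbound : ∀ {F : Type} [NormedAddCommGroup F] {f : Rn n → F},
      AEStronglyMeasurable f (volume.restrict Ω) →
      eLpNorm f (ENNReal.ofReal t) (volume.restrict Ω) ≤ ε / c →
      eLpNorm f (ENNReal.ofReal s) (volume.restrict Ω) ≤ ε := by
    intro F _ f hf hle
    have := eLpNorm_le_eLpNorm_mul_rpow_measure_univ (μ := volume.restrict Ω) h hf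
    rw [ENNReal.toReal_ofReal (by linarith), ENNReal.toReal_ofReal (by linarith),
      Measure.restrict_apply_univ] at this
    refine this.trans ?_
    calc _ ≤ ε / c * c := by gcongr
      _ ≤ ε := by rw [mul_comm]; exact ENNReal.mul_div_le
  obtain ⟨φ, hφ, ha, hb⟩ := h4 (ε / c) (ENNReal.div_pos hε.ne' hc_top)
  exact ⟨φ, hφ, hbound (h2.1.sub hφ.contDiff.continuous.aestronglyMeasurable) ha,
    hbound (h3.1.sub (continuous_gradient hφ.contDiff).aestronglyMeasurable) hb⟩

end Sobolev

/-! ### Gradients of functions in `W₀^{1,s}` -/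

section Gradients

variable {n : ℕ} {Ω : Set (Rn n)}

lemma IsWeakGradient.congr_gradient {u : Rn n → ℝ} {G H : Rn n → Rn n} (h : IsWeakGradient Ω u G)
    (e : G =ᵐ[volume.restrict Ω] H) : IsWeakGradient Ω u H := by
  refine ⟨h.1, locallyIntegrableOn_congr e h.2, fun φ k1 k2 k3 v => ?_⟩
  rw [h.3 φ k1 k2 k3 v]
  congr 1
  refine integral_congr_ae ?_
  filter_upwards [e] with x hx
  rw [hx]

/-- The gradients of test functions, as elements of `L^s`. -/
def testGradients (Ω : Set (Rn n)) (s : ℝ) :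
    Set (Lp (Rn n) (ENNReal.ofReal s) (volume.restrict Ω)) :=
  {H | ∃ φ : Rn n → ℝ, IsTestC1 Ω φ ∧ H =ᵐ[volume.restrict Ω] gradient φ}

lemma IsTestC1.add {φ ψ : Rn n → ℝ} (hφ : IsTestC1 Ω φ) (hψ : IsTestC1 Ω ψ) : IsTestC1 Ω (φ + ψ) :=
  ⟨hφ.1.add hψ.1, hφ.2.add hψ.2, (tsupport_add φ ψ).trans (union_subset hφ.3 hψ.3)⟩

lemma IsTestC1.smul {φ : Rn n → ℝ} (c : ℝ) (hφ : IsTestC1 Ω φ) : IsTestC1 Ω (c • φ) :=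
  ⟨hφ.1.const_smul c, hφ.2.smul_left (f := fun _ => c),
    (closure_mono (Function.support_const_smul_subset c φ)).trans hφ.3⟩

lemma IsTestC1.sub {φ ψ : Rn n → ℝ} (hφ : IsTestC1 Ω φ) (hψ : IsTestC1 Ω ψ) :
    IsTestC1 Ω (φ - ψ) := by
  have := hφ.add (hψ.smul (-1))
  rwa [neg_one_smul, ← sub_eq_add_neg] at this

lemma IsTestC1.gradient_sub {φ ψ : Rn n → ℝ} (hφ : IsTestC1 Ω φ) (hψ : IsTestC1 Ω ψ) :
    gradient (φ - ψ) = gradient φ - gradient ψ := by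
  have h := gradient_add hφ.1 (hψ.smul (-1)).1
  rw [gradient_smul _ hψ.1, neg_one_smul, neg_one_smul, ← sub_eq_add_neg, ← sub_eq_add_neg] at h
  exact h

lemma IsTestC1.memLp {φ : Rn n → ℝ} (hφ : IsTestC1 Ω φ) (r : ℝ≥0∞) :
    MemLp φ r (volume.restrict Ω) :=
  (hφ.contDiff.continuous.memLp_of_hasCompactSupport hφ.compact).restrict Ω

lemma IsTestC1.memLp_gradient {φ : Rn n → ℝ} (hφ : IsTestC1 Ω φ) (r : ℝ≥0∞) :
    MemLp (gradient φ) r (volume.restrict Ω) := by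
  refine ((continuous_gradient hφ.contDiff).memLp_of_hasCompactSupport ?_).restrict Ω
  exact HasCompactSupport.of_support_subset_isCompact hφ.compact (support_gradient_subset φ)

lemma convex_testGradients (s : ℝ) : Convex ℝ (testGradients Ω s) := by
  rintro H ⟨φ, hφ, e⟩ H' ⟨ψ, hψ, e'⟩ a b - - -
  refine ⟨a • φ + b • ψ, (hφ.smul a).add (hψ.smul b), ?_⟩
  rw [gradient_add (hφ.smul a).1 (hψ.smul b).1, gradient_smul _ hφ.1, gradient_smul _ hψ.1]
  filter_upwards [Lp.coeFn_add (a • H) (b • H'), Lp.coeFn_smul a H, Lp.coeFn_smul b H', e, e']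
    with x h1 h2 h3 h4 h5
  rw [h1, Pi.add_apply, h2, h3]
  simp only [Pi.smul_apply, Pi.add_apply, h4, h5]

variable {s : ℝ}

/-- Every limit of gradients of test functions is the gradient of a function in `W₀^{1,s}`. -/
lemma exists_sobolevZero_of_mem_closure [IsFiniteMeasure (volume.restrict Ω)]
    [Fact (1 ≤ ENNReal.ofReal s)] (hn : 0 < n)
    (hΩ : Bornology.IsBounded Ω) (hs : 1 < s)
    {H : Lp (Rn n) (ENNReal.ofReal s) (volume.restrict Ω)}
    (hH : H ∈ closure (testGradients Ω s)) :
    ∃ w ∈ sobolevZero Ω s, IsWeakGradient Ω w H := by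
  obtain ⟨C, hC, hP⟩ := exists_eLpNorm_le_eLpNorm_gradient hn hΩ hs
  obtain ⟨y, hy, hyH⟩ := mem_closure_iff_seq_limit.1 hH
  choose φ hφ hyφ using hy
  -- By the Poincaré inequality for differences of test functions, convergence of the gradients
  -- forces the test functions themselves to be Cauchy in `L^s`.
  set F : ℕ → Lp ℝ (ENNReal.ofReal s) (volume.restrict Ω) := fun k =>
    ((hφ k).memLp (ENNReal.ofReal s)).toLp (φ k) with hF
  have hdist : ∀ k j, edist (F k) (F j) ≤ C * edist (y k) (y j) := by
    intro k j
    rw [Lp.edist_toLp_toLp, Lp.edist_def]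
    have e : (y k : Rn n → Rn n) - (y j : Rn n → Rn n) =ᵐ[volume.restrict Ω] gradient (φ k - φ j) := by
      rw [(hφ k).gradient_sub (hφ j)]
      exact (hyφ k).sub (hyφ j)
    rw [eLpNorm_congr_ae e]
    exact hP _ ((hφ k).sub (hφ j))
  have hcauchy : CauchySeq F := by
    have hyc := hyH.cauchySeq
    rw [EMetric.cauchySeq_iff] at hyc ⊢
    intro ε hε
    obtain ⟨N, hN⟩ := hyc (ε / (C + 1)) (ENNReal.div_pos hε.ne' (by finiteness))
    refine ⟨N, fun k hk j hj => ?_⟩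
    have h1 := hN k hk j hj
    rw [ENNReal.lt_div_iff_mul_lt (Or.inl (by simp)) (Or.inl (by finiteness))] at h1
    refine ((hdist k j).trans ?_).trans_lt h1
    rw [mul_comm]
    gcongr
    exact le_self_add
  obtain ⟨w, hw⟩ := cauchySeq_tendsto_of_complete hcauchy
  have happ : ∀ ε : ℝ≥0∞, 0 < ε → ∃ φ : Rn n → ℝ, IsTestC1 Ω φ ∧
      eLpNorm ((w : Rn n → ℝ) - φ) (ENNReal.ofReal s) (volume.restrict Ω) ≤ ε ∧
      eLpNorm ((H : Rn n → Rn n) - gradient φ) (ENNReal.ofReal s) (volume.restrict Ω) ≤ ε := by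
    intro ε hε
    obtain ⟨k, hk1, hk2⟩ := (((EMetric.tendsto_nhds.1 hw) ε hε).and
      ((EMetric.tendsto_nhds.1 hyH) ε hε)).exists
    refine ⟨φ k, hφ k, ?_, ?_⟩
    · rw [edist_comm, Lp.edist_def] at hk1
      rw [← eLpNorm_congr_ae ((EventuallyEq.refl _ _).sub (MemLp.coeFn_toLp ((hφ k).memLp _)))]
      exact hk1.le
    · rw [edist_comm, Lp.edist_def] at hk2
      rw [← eLpNorm_congr_ae ((EventuallyEq.refl _ _).sub (hyφ k))]
      exact hk2.le
  have hwg : IsWeakGradient Ω w H := isWeakGradient_of_approx hs.le (Lp.memLp w) (Lp.memLp H)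
    fun ε hε => by
      obtain ⟨φ, h, h'⟩ := happ ε hε
      exact ⟨φ, h.contDiff, h'⟩
  exact ⟨w, ⟨H, hwg, Lp.memLp w, Lp.memLp H, happ⟩, hwg⟩

/-- The gradient of a function in `W₀^{1,s}` is a limit of gradients of test functions. -/
lemma exists_mem_closure_of_sobolevZero [Fact (1 ≤ ENNReal.ofReal s)] {w : Fun Ω}
    (hw : w ∈ sobolevZero Ω s) : ∃ H ∈ closure (testGradients Ω s), IsWeakGradient Ω w H := by
  obtain ⟨G, h1, -, h3, h4⟩ := hw
  refine ⟨h3.toLp G, ?_, ?_⟩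
  · rw [EMetric.mem_closure_iff]
    intro ε hε
    obtain ⟨η, hη, hηε⟩ := exists_between hε
    obtain ⟨φ, hφ, -, hb⟩ := h4 η hη
    refine ⟨(hφ.memLp_gradient _).toLp _, ⟨φ, hφ, MemLp.coeFn_toLp _⟩, ?_⟩
    rw [Lp.edist_toLp_toLp]
    exact hb.trans_lt hηε
  · exact h1.congr_gradient (MemLp.coeFn_toLp h3).symm

/-- A test function within `ε` of `w` has gradient of norm at most `ε`, hence norm at most `C * ε`
by Poincaré; so `w` has norm at most `(1 + C) * ε`. -/
lemma eq_zero_of_sobolevZero (hn : 0 < n) (hΩo : IsOpen Ω)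
    (hΩ : Bornology.IsBounded Ω) (hs : 1 < s) {w : Fun Ω} (hw : w ∈ sobolevZero Ω s)
    (hw0 : IsWeakGradient Ω w 0) : w = 0 := by
  obtain ⟨C, hC, hP⟩ := exists_eLpNorm_le_eLpNorm_gradient hn hΩ hs
  obtain ⟨G, h1, h2, -, h4⟩ := hw
  have hG : G =ᵐ[volume.restrict Ω] 0 := h1.ae_eq hΩo hw0
  have hnorm : eLpNorm w (ENNReal.ofReal s) (volume.restrict Ω) = 0 := by
    refine eq_zero_of_forall_le_mul (K := 1 + C) (by finiteness) fun ε hε => ?_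
    obtain ⟨φ, hφ, ha, hb⟩ := h4 ε hε
    have e : G - gradient φ =ᵐ[volume.restrict Ω] -gradient φ := by
      filter_upwards [hG] with x hx
      simp [hx]
    rw [eLpNorm_congr_ae e, eLpNorm_neg] at hb
    have hs1 : 1 ≤ ENNReal.ofReal s := one_le_ofReal hs.le
    calc eLpNorm w (ENNReal.ofReal s) (volume.restrict Ω)
        = eLpNorm (((w : Rn n → ℝ) - φ) + φ) (ENNReal.ofReal s) (volume.restrict Ω) := by
          rw [sub_add_cancel]
      _ ≤ ε + C * ε := by
          refine (eLpNorm_add_le (h2.1.sub (hφ.memLp (ENNReal.ofReal s)).1)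
            (hφ.memLp (ENNReal.ofReal s)).1 hs1).trans (add_le_add ha ?_)
          exact (hP φ hφ).trans (by gcongr)
      _ = (1 + C) * ε := by ring
  rw [eLpNorm_eq_zero_iff h2.1 (by simp; linarith)] at hnorm
  exact AEEqFun.ext (hnorm.trans AEEqFun.coeFn_zero.symm)

lemma gradient_mul {χ φ : Rn n → ℝ} (h : ContDiff ℝ 1 χ) (k : ContDiff ℝ 1 φ) :
    gradient (fun x => χ x * φ x) = fun x => χ x • gradient φ x + φ x • gradient χ x := by
  funext x
  simp only [gradient]
  rw [fderiv_fun_mul (h.differentiable (by simp) x) (k.differentiable (by simp) x)]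
  simp

/-- Multiplication by a test function maps `W^{1,s}`-limits of `C¹` functions to `W₀^{1,s}`. -/
lemma exists_sobolevZero_mul [IsFiniteMeasure (volume.restrict Ω)] (hs : 1 < s)
    {g : Rn n → ℝ} {G : Rn n → Rn n}
    (hg : MemLp g (ENNReal.ofReal s) (volume.restrict Ω))
    (hG : MemLp G (ENNReal.ofReal s) (volume.restrict Ω))
    (happ : ∀ ε : ℝ≥0∞, 0 < ε → ∃ φ : Rn n → ℝ, ContDiff ℝ 1 φ ∧
      eLpNorm (g - φ) (ENNReal.ofReal s) (volume.restrict Ω) ≤ ε ∧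
      eLpNorm (G - gradient φ) (ENNReal.ofReal s) (volume.restrict Ω) ≤ ε)
    {χ : Rn n → ℝ} (hχ : IsTestC1 Ω χ) :
    ∃ w ∈ sobolevZero Ω s, IsWeakGradient Ω w (fun x => χ x • G x + g x • gradient χ x) ∧
      MemLp (fun x => χ x • G x + g x • gradient χ x) (ENNReal.ofReal s) (volume.restrict Ω) := by
  have hcχ := hχ.contDiff.continuous
  have hcg := continuous_gradient hχ.contDiff
  obtain ⟨M₁, hM₁⟩ := hcχ.bounded_above_of_compact_support hχ.compact
  obtain ⟨M₂, hM₂⟩ := hcg.bounded_above_of_compact_support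
    (HasCompactSupport.of_support_subset_isCompact hχ.compact (support_gradient_subset χ))
  set r := ENNReal.ofReal s with hr
  have hr1 : 1 ≤ r := one_le_ofReal hs.le
  set M : ℝ≥0 := (max M₁ M₂).toNNReal with hM
  have hMb : max M₁ M₂ ≤ M := Real.le_coe_toNNReal _
  have hb1 : ∀ x, ‖χ x‖₊ ≤ M := fun x => by
    rw [← NNReal.coe_le_coe, coe_nnnorm]
    exact (hM₁ x).trans ((le_max_left _ _).trans hMb)
  have hb2 : ∀ x, ‖gradient χ x‖₊ ≤ M := fun x => by
    rw [← NNReal.coe_le_coe, coe_nnnorm]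
    exact (hM₂ x).trans ((le_max_right _ _).trans hMb)
  have bound1 : ∀ {F : Type} [NormedAddCommGroup F] [NormedSpace ℝ F] (f : Rn n → F),
      eLpNorm (fun x => χ x • f x) r (volume.restrict Ω) ≤ M * eLpNorm f r (volume.restrict Ω) := by
    intro F _ _ f
    refine (eLpNorm_le_nnreal_smul_eLpNorm_of_ae_le_mul (c := M)
      (Eventually.of_forall fun x => ?_) r).trans_eq (by rw [ENNReal.smul_def, smul_eq_mul])
    rw [nnnorm_smul]
    gcongr
    exact hb1 x
  have bound2 : ∀ f : Rn n → ℝ, eLpNorm (fun x => f x • gradient χ x) r (volume.restrict Ω) ≤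
      M * eLpNorm f r (volume.restrict Ω) := by
    intro f
    refine (eLpNorm_le_nnreal_smul_eLpNorm_of_ae_le_mul (c := M)
      (Eventually.of_forall fun x => ?_) r).trans_eq (by rw [ENNReal.smul_def, smul_eq_mul])
    rw [nnnorm_smul, mul_comm]
    gcongr
    exact hb2 x
  have hm1 : ∀ {F : Type} [NormedAddCommGroup F] [NormedSpace ℝ F] {f : Rn n → F},
      AEStronglyMeasurable f (volume.restrict Ω) →
      AEStronglyMeasurable (fun x => χ x • f x) (volume.restrict Ω) :=
    fun hf => hcχ.aestronglyMeasurable.smul hf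
  have hm2 : ∀ {f : Rn n → ℝ}, AEStronglyMeasurable f (volume.restrict Ω) →
      AEStronglyMeasurable (fun x => f x • gradient χ x) (volume.restrict Ω) :=
    fun hf => hf.smul hcg.aestronglyMeasurable
  have hMem1 : ∀ {F : Type} [NormedAddCommGroup F] [NormedSpace ℝ F] {f : Rn n → F},
      MemLp f r (volume.restrict Ω) → MemLp (fun x => χ x • f x) r (volume.restrict Ω) :=
    fun hf => ⟨hm1 hf.1, (bound1 _).trans_lt (ENNReal.mul_lt_top ENNReal.coe_lt_top hf.2)⟩
  have hMem2 : MemLp (fun x => g x • gradient χ x) r (volume.restrict Ω) :=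
    ⟨hm2 hg.1, (bound2 _).trans_lt (ENNReal.mul_lt_top ENNReal.coe_lt_top hg.2)⟩
  have hχg : MemLp (fun x => χ x • g x) r (volume.restrict Ω) := hMem1 hg
  have hH := (hMem1 hG).add hMem2
  set w : Fun Ω := AEEqFun.mk _ hχg.1 with hw
  have hwe : w =ᵐ[volume.restrict Ω] fun x => χ x • g x := AEEqFun.coeFn_mk _ _
  have hwm : MemLp w r (volume.restrict Ω) := (memLp_congr_ae hwe).2 hχg
  have hwapp : ∀ ε : ℝ≥0∞, 0 < ε → ∃ φ : Rn n → ℝ, IsTestC1 Ω φ ∧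
      eLpNorm ((w : Rn n → ℝ) - φ) r (volume.restrict Ω) ≤ ε ∧
      eLpNorm ((fun x => χ x • G x + g x • gradient χ x) - gradient φ) r (volume.restrict Ω)
        ≤ ε := by
    intro ε hε
    -- The product rule gives two error terms, each at most `M` times the tolerance.
    obtain ⟨φ, hφ, ha, hb⟩ := happ (ε / (2 * M + 1)) (ENNReal.div_pos hε.ne' (by finiteness))
    have hle : (2 * M + 1) * (ε / (2 * M + 1)) ≤ ε := ENNReal.mul_div_le
    refine ⟨fun x => χ x * φ x, ⟨hχ.contDiff.mul hφ, hχ.compact.mul_right,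
      (tsupport_mul_subset_left).trans hχ.support⟩, ?_, ?_⟩
    · have e : (w : Rn n → ℝ) - (fun x => χ x * φ x) =ᵐ[volume.restrict Ω]
          fun x => χ x • (g - φ) x := by
        filter_upwards [hwe] with x hx
        simp only [Pi.sub_apply, hx, smul_eq_mul]
        ring
      rw [eLpNorm_congr_ae e]
      refine (bound1 _).trans (le_trans ?_ hle)
      gcongr
      calc (M : ℝ≥0∞) ≤ M + (M + 1) := le_self_add
        _ = 2 * M + 1 := by ring
    · have e : (fun x => χ x • G x + g x • gradient χ x) - gradient (fun x => χ x * φ x) =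
          (fun x => χ x • (G - gradient φ) x) + fun x => (g - φ) x • gradient χ x := by
        rw [gradient_mul hχ.contDiff hφ]
        funext x
        simp only [Pi.sub_apply, Pi.add_apply, smul_sub, sub_smul]
        abel
      rw [e]
      refine (eLpNorm_add_le (hm1 (hG.1.sub (continuous_gradient hφ).aestronglyMeasurable))
        (hm2 (hg.1.sub hφ.continuous.aestronglyMeasurable)) hr1).trans (le_trans ?_ hle)
      calc _ ≤ (M : ℝ≥0∞) * (ε / (2 * M + 1)) + M * (ε / (2 * M + 1)) :=
            add_le_add ((bound1 _).trans (by gcongr)) ((bound2 _).trans (by gcongr))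
        _ = (2 * M) * (ε / (2 * M + 1)) := by ring
        _ ≤ _ := by gcongr; exact le_self_add
  have hwg := isWeakGradient_of_approx hs.le hwm hH fun ε hε => by
    obtain ⟨φ, h, h'⟩ := hwapp ε hε
    exact ⟨φ, h.contDiff, h'⟩
  exact ⟨w, ⟨_, hwg, hwm, hH, hwapp⟩, hwg, hH⟩

end Gradients

/-! ### Lipschitz boundaries and cutoff functions -/

section Geometry

variable {n : ℕ}

/-- The translates of a graph by distinct multiples of its vertical direction are disjoint. A set
with infinitely many disjoint translates by a bounded family of vectors is null. -/
lemma volume_lipschitzGraph_eq_zero {ν : Rn n} (hν : ‖ν‖ = 1) {γ : Rn n → ℝ} (hγ : Continuous γ) :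
    volume {y : Rn n | γ (y - inner ℝ ν y • ν) = inner ℝ ν y} = 0 := by
  have hνν : inner ℝ ν ν = 1 := by rw [real_inner_self_eq_norm_sq, hν, one_pow]
  have hclosed : IsClosed {y : Rn n | γ (y - inner ℝ ν y • ν) = inner ℝ ν y} :=
    isClosed_eq (hγ.comp (by fun_prop)) (by fun_prop)
  refine Measure.addHaar_eq_zero_of_disjoint_translates volume
    (fun k : ℕ => (1 / ((k : ℝ) + 1)) • ν) ?_ ?_ hclosed.measurableSet
  · have h := (tendsto_one_div_add_atTop_nhds_zero_nat (𝕜 := ℝ)).smul_const ν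
    exact Metric.isBounded_range_of_tendsto _ h
  · intro k j hkj
    rw [Function.onFun, Set.disjoint_left]
    rintro z hz hz'
    rw [singleton_add] at hz hz'
    obtain ⟨y, hy, rfl⟩ := hz
    obtain ⟨y', hy', h⟩ := hz'
    simp only [mem_ofPred_eq] at hy hy' h
    set s : ℝ := 1 / ((k : ℝ) + 1) with hs
    set t : ℝ := 1 / ((j : ℝ) + 1) with ht
    have h1 : y' = y + (s - t) • ν := by
      rw [sub_smul]
      have : y' = s • ν + y - t • ν := by rw [← h]; abel
      rw [this]; abel
    have h2 : inner ℝ ν y' = inner ℝ ν y + (s - t) := by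
      rw [h1, inner_add_right, inner_smul_right, hνν, mul_one]
    have h3 : y' - inner ℝ ν y' • ν = y - inner ℝ ν y • ν := by
      rw [h2, add_smul, h1]; abel
    rw [h3, hy, h2] at hy'
    have h4 : s = t := by linarith
    rw [hs, ht, one_div, one_div, inv_inj, add_left_inj, Nat.cast_inj] at h4
    exact hkj h4

/-- In a chart, points strictly above the graph are interior to `U` and points strictly below are
exterior, so the frontier lies on the graph. -/
lemma HasLipschitzBoundary.volume_frontier {U : Set (Rn n)} (hU : HasLipschitzBoundary U) :
    volume (frontier U) = 0 := by
  refine measure_null_of_locally_null _ fun x hx => ?_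
  obtain ⟨ν, hν, r, hr, K, γ, hγ, h⟩ := hU x hx
  refine ⟨frontier U ∩ Metric.ball x r,
    inter_mem_nhdsWithin _ (Metric.ball_mem_nhds x hr), ?_⟩
  refine measure_mono_null ?_ (volume_lipschitzGraph_eq_zero hν hγ.continuous)
  rintro y ⟨hyU, hyr⟩
  have hb : Metric.ball x r ∈ 𝓝 y := Metric.isOpen_ball.mem_nhds hyr
  have hc : Continuous fun y : Rn n => γ (y - inner ℝ ν y • ν) :=
    hγ.continuous.comp (by fun_prop)
  have hc' : Continuous fun y : Rn n => inner ℝ ν y := by fun_prop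
  rcases lt_trichotomy (γ (y - inner ℝ ν y • ν)) (inner ℝ ν y) with hlt | heq | hgt
  · exfalso
    refine hyU.2 (mem_interior_iff_mem_nhds.2 ?_)
    filter_upwards [hb, (isOpen_lt hc hc').mem_nhds hlt] with z hz hz'
    exact (h z hz).2 hz'
  · exact heq
  · exfalso
    have : Uᶜ ∈ 𝓝 y := by
      filter_upwards [hb, (isOpen_lt hc' hc).mem_nhds hgt] with z hz hz' hzU
      exact absurd ((h z hz).1 hzU) (not_lt.2 (le_of_lt hz'))
    obtain ⟨z, hz1, hz2⟩ := mem_closure_iff_nhds.1 hyU.1 _ this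
    exact hz1 hz2

lemma exists_isTestC1_eq_one {Ω K : Set (Rn n)} (hΩ : IsOpen Ω) (hK : IsCompact K) (hKΩ : K ⊆ Ω) :
    ∃ χ : Rn n → ℝ, IsTestC1 Ω χ ∧ ∀ x ∈ K, χ x = 1 := by
  obtain ⟨L, hL, hKL, hLΩ⟩ := exists_compact_between hK hΩ hKΩ
  obtain ⟨χ, h1, h0, -⟩ := exists_contMDiffMap_one_nhds_of_subset_interior
    (modelWithCornersSelf ℝ (Rn n)) (n := 1) hK.isClosed hKL
  have hsupp : tsupport χ ⊆ L := closure_minimal (fun x hx => by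
    by_contra h
    exact hx (h0 x h)) hL.isClosed
  refine ⟨χ, ⟨?_, HasCompactSupport.of_support_subset_isCompact hL
    ((subset_tsupport _).trans hsupp), hsupp.trans hLΩ⟩, fun x hx => ?_⟩
  · exact contMDiff_iff_contDiff.1 χ.contMDiff
  · exact h1.self_of_nhdsSet x hx

end Geometry

/-! ### The two-phase energy -/

section Energy

variable {n : ℕ} {Ω A : Set (Rn n)} {p q : ℝ} {QB QA : Rn n → ℝ → ℝ}

lemma rpow_le_one_add_rpow {t a b : ℝ} (ht : 0 ≤ t) (ha : 0 ≤ a) (hab : a ≤ b) :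
    t ^ a ≤ 1 + t ^ b := by
  rcases le_total t 1 with h | h
  · have := Real.rpow_le_one ht h ha
    have := Real.rpow_nonneg ht b
    linarith
  · have := Real.rpow_le_rpow_of_exponent_le h hab
    linarith

open Classical in
/-- The density of the two-phase energy. -/
noncomputable def twoPhaseDensity (A : Set (Rn n)) (QB QA : Rn n → ℝ → ℝ) (x : Rn n) : ℝ → ℝ :=
  if x ∈ A then QA x else QB x

/-- The energy ignores the interface `frontier A`. Since it is null, the two phases fill `Ω` and a
single density on `Ω` represents the energy. -/
lemma restrict_eq_add (hA : IsOpen A) (hAΩ : closure A ⊆ Ω) (hlip : HasLipschitzBoundary A) :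
    (volume.restrict Ω : Measure (Rn n)) =
      volume.restrict (Ω \ closure A) + volume.restrict A := by
  have hdisj : Disjoint (Ω \ closure A) A :=
    Set.disjoint_left.2 fun x hx hxA => hx.2 (subset_closure hxA)
  rw [← Measure.restrict_union hdisj hA.measurableSet]
  refine Measure.restrict_congr_set ?_
  have hnull := hlip.volume_frontier
  have : ∀ᵐ x : Rn n, x ∉ frontier A := measure_eq_zero_iff_ae_notMem.1 hnull
  filter_upwards [this] with x hx
  refine propext ⟨fun h => ?_, fun h => ?_⟩
  · by_cases hc : x ∈ closure A
    · right
      by_contra hxA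
      refine hx ⟨hc, ?_⟩
      rwa [hA.interior_eq]
    · exact Or.inl ⟨h, hc⟩
  · rcases h with h | h
    · exact h.1
    · exact hAΩ (subset_closure h)

lemma ae_twoPhaseDensity_outside (hΩ : IsOpen Ω) :
    ∀ᵐ x ∂(volume.restrict (Ω \ closure A)), twoPhaseDensity A QB QA x = QB x := by
  filter_upwards [ae_restrict_mem (hΩ.measurableSet.diff isClosed_closure.measurableSet)] with x hx
  exact if_neg fun h => hx.2 (subset_closure h)

lemma ae_twoPhaseDensity_inside (hA : IsOpen A) :
    ∀ᵐ x ∂(volume.restrict A), twoPhaseDensity A QB QA x = QA x := by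
  filter_upwards [ae_restrict_mem hA.measurableSet] with x hx
  exact if_pos hx

lemma HasGrowth.coercive {U : Set (Rn n)} {Q : Rn n → ℝ → ℝ} {s₀ s c C E₀ m : ℝ}
    (h : HasGrowth U Q s₀ s c C E₀) (hc : 0 < c) (hE : 0 < E₀) (hm : 0 ≤ m) (hms : m ≤ s) :
    ∀ᵐ x ∂(volume.restrict U), ∀ t : ℝ, 0 ≤ t → t ^ m ≤ 1 + E₀ ^ s / c * Q x t := by
  filter_upwards [h] with x hx t ht
  refine (rpow_le_one_add_rpow ht hm hms).trans ?_
  have h1 := (mul_le_mul_of_nonneg_left (le_max_right ((t / E₀) ^ s₀) ((t / E₀) ^ s)) hc.le).trans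
    (hx t ht).1
  rw [Real.div_rpow ht hE.le] at h1
  have h2 : 0 < E₀ ^ s := by positivity
  have h3 : t ^ s = E₀ ^ s / c * (c * (t ^ s / E₀ ^ s)) := by field_simp
  rw [h3]
  gcongr

/-- Any exponent below both `p` and `q` is controlled in both phases; adding the constants of the
two phases gives one that serves on both sides. -/
lemma isCoerciveIntegrand_twoPhaseDensity (hΩ : IsOpen Ω) (hA : IsOpen A) (hAΩ : closure A ⊆ Ω)
    (hlip : HasLipschitzBoundary A)
    (hB1 : IsCaratheodory (Ω \ closure A) QB) (hA1 : IsCaratheodory A QA)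
    (hB2 : IsConvexDensity (Ω \ closure A) QB) (hA2 : IsConvexDensity A QA)
    {p₀ q₀ c C E₀ m : ℝ} (hc : 0 < c) (hE : 0 < E₀) (hm : 0 ≤ m) (hmp : m ≤ p) (hmq : m ≤ q)
    (hB3 : HasGrowth (Ω \ closure A) QB p₀ p c C E₀) (hA3 : HasGrowth A QA q₀ q c C E₀) :
    IsCoerciveIntegrand (volume.restrict Ω) (twoPhaseDensity A QB QA) m
      (1 + E₀ ^ p / c + E₀ ^ q / c) := by
  have hB := ae_twoPhaseDensity_outside (A := A) (QB := QB) (QA := QA) hΩ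
  have hA' := ae_twoPhaseDensity_inside (QB := QB) (QA := QA) hA
  have hp0 : 0 < E₀ ^ p / c := by positivity
  have hq0 : 0 < E₀ ^ q / c := by positivity
  have hae : ∀ P : Rn n → (ℝ → ℝ) → Prop,
      (∀ᵐ x ∂(volume.restrict (Ω \ closure A)), P x (QB x)) →
      (∀ᵐ x ∂(volume.restrict A), P x (QA x)) →
      ∀ᵐ x ∂(volume.restrict Ω), P x (twoPhaseDensity A QB QA x) := by
    intro P h1 h2
    rw [restrict_eq_add hA hAΩ hlip, ae_add_measure_iff]
    constructor
    · filter_upwards [h1, hB] with x hx e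
      rwa [e]
    · filter_upwards [h2, hA'] with x hx e
      rwa [e]
  refine ⟨fun t ht => ?_, hae (fun _ f => ContinuousOn f (Ici 0)) hB1.2 hA1.2,
    hae (fun _ f => ∀ t : ℝ, 0 ≤ t → 0 ≤ f t) (hB2.mono fun x h => h.1) (hA2.mono fun x h => h.1),
    hae (fun _ f => StrictConvexOn ℝ (Ici 0) f) (hB2.mono fun x h => h.2.2.1)
      (hA2.mono fun x h => h.2.2.1),
    hae (fun _ f => f 0 = 0) (hB2.mono fun x h => h.2.2.2) (hA2.mono fun x h => h.2.2.2),
    hae (fun _ f => ∀ t : ℝ, 0 ≤ t → t ^ m ≤ (1 + E₀ ^ p / c + E₀ ^ q / c) * (1 + f t)) ?_ ?_⟩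
  · rw [restrict_eq_add hA hAΩ hlip]
    refine AEMeasurable.add_measure ?_ ?_
    · refine (hB1.1 t ht).congr ?_
      filter_upwards [hB] with x e
      rw [e]
    · refine (hA1.1 t ht).congr ?_
      filter_upwards [hA'] with x e
      rw [e]
  · filter_upwards [hB3.coercive hc hE hm hmp, hB2] with x h1 h2 t ht
    have := h1 t ht
    have := h2.1 t ht
    nlinarith [mul_nonneg hq0.le this]
  · filter_upwards [hA3.coercive hc hE hm hmq, hA2] with x h1 h2 t ht
    have := h1 t ht
    have := h2.1 t ht
    nlinarith [mul_nonneg hp0.le this]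

lemma energy_twoPhaseDensity (hΩ : IsOpen Ω) (hA : IsOpen A) (hAΩ : closure A ⊆ Ω)
    (hlip : HasLipschitzBoundary A) (v : Rn n → Rn n) :
    energy (volume.restrict Ω) (twoPhaseDensity A QB QA) v =
      (∫⁻ x in Ω \ closure A, ENNReal.ofReal (QB x ‖v x‖)) +
        ∫⁻ x in A, ENNReal.ofReal (QA x ‖v x‖) := by
  rw [energy, restrict_eq_add hA hAΩ hlip, lintegral_add_measure]
  congr 1
  · refine lintegral_congr_ae ?_
    filter_upwards [ae_twoPhaseDensity_outside hΩ] with x e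
    rw [e]
  · refine lintegral_congr_ae ?_
    filter_upwards [ae_twoPhaseDensity_inside hA] with x e
    rw [e]

lemma dirichletEnergy_eq_energy (hΩ : IsOpen Ω) (hA : IsOpen A) (hAΩ : closure A ⊆ Ω)
    (hlip : HasLipschitzBoundary A) {u : Fun Ω} {v : Rn n → Rn n} (h : IsWeakGradient Ω u v) :
    dirichletEnergy Ω A QB QA u =
      energy (volume.restrict Ω) (twoPhaseDensity A QB QA) v := by
  rw [← energy_congr (weakGradient_ae_eq hΩ h), energy_twoPhaseDensity hΩ hA hAΩ hlip]
  rfl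

/-- A field in `L^p` which vanishes on the inclusion `A` has finite energy. -/
lemma energy_ne_top (hΩ : IsOpen Ω) (hA : IsOpen A) (hAΩ : closure A ⊆ Ω)
    [IsFiniteMeasure (volume.restrict Ω)]
    (hlip : HasLipschitzBoundary A) (hA2 : IsConvexDensity A QA) {p₀ c C E₀ : ℝ}
    (hp₀ : 1 < p₀) (hp₀p : p₀ ≤ p) (hC : 0 < C) (hE : 0 < E₀)
    (hB3 : HasGrowth (Ω \ closure A) QB p₀ p c C E₀)
    {v : Rn n → Rn n} (hv : MemLp v (ENNReal.ofReal p) (volume.restrict Ω))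
    (hvA : ∀ x ∈ A, v x = 0) :
    energy (volume.restrict Ω) (twoPhaseDensity A QB QA) v ≠ ⊤ := by
  have hp0 : 0 < p := by linarith
  have hzero : ∫⁻ x in A, ENNReal.ofReal (QA x ‖v x‖) = 0 := by
    rw [lintegral_congr_ae (g := fun _ => 0), lintegral_zero]
    filter_upwards [hA2, ae_restrict_mem hA.measurableSet] with x h hx
    rw [hvA x hx, norm_zero, h.2.2.2, ENNReal.ofReal_zero]
  rw [energy_twoPhaseDensity hΩ hA hAΩ hlip, hzero, add_zero]
  have hint : Integrable (fun x => C * (1 + ‖v x‖ ^ p / E₀ ^ p)) (volume.restrict Ω) := by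
    have h := hv.integrable_norm_rpow (by simpa using hp0) ENNReal.ofReal_ne_top
    rw [ENNReal.toReal_ofReal hp0.le] at h
    exact ((integrable_const 1).add (h.div_const _)).const_mul _
  refine ne_top_of_le_ne_top (hint.mono_measure
    (Measure.restrict_mono_set volume (sdiff_subset (s := Ω) (t := closure A)))).lintegral_lt_top.ne
    (lintegral_mono_ae ?_)
  filter_upwards [hB3] with x hx
  refine ENNReal.ofReal_le_ofReal ((hx _ (norm_nonneg _)).2.trans ?_)
  have h0 : 0 ≤ ‖v x‖ / E₀ := by positivity
  rw [← Real.div_rpow (norm_nonneg _) hE.le]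
  refine mul_le_mul_of_nonneg_left (max_le (rpow_le_one_add_rpow h0 (by linarith) hp₀p) ?_) hC.le
  linarith

/-- Both alternatives of the boundary condition, and any change of representative, stay inside the
larger space `W₀^{1, min p q}`. Conversely, `min p q` is one of the two exponents, so that
alternative holds with `g` itself. -/
lemma mem_admissible_iff [IsFiniteMeasure (volume.restrict Ω)] (hp : 1 < p) (hq : 1 < q)
    (g : sobolev Ω p) (u : Fun Ω) :
    u ∈ admissible Ω p q (Submodule.Quotient.mk g) ↔
      u - (g : Fun Ω) ∈ sobolevZero Ω (min p q) := by
  have hm : 1 ≤ min p q := (lt_min hp hq).le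
  constructor
  · rintro ⟨-, g', hg', h⟩
    have h1 : u - (g' : Fun Ω) ∈ sobolevZero Ω (min p q) := by
      rcases h with h | h
      · exact sobolevZero_mono hm (min_le_left p q) h
      · exact sobolevZero_mono hm (min_le_right p q) h
    have h2 : (g' : Fun Ω) - (g : Fun Ω) ∈ sobolevZero Ω p :=
      (Submodule.Quotient.eq ((sobolevZero Ω p).submoduleOf (sobolev Ω p))).1 hg'
    have := add_mem h1 (sobolevZero_mono hm (min_le_left p q) h2)
    rwa [sub_add_sub_cancel] at this
  · intro h
    have hu : u ∈ sobolev Ω (min p q) := by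
      have := add_mem (sobolevZero_le_sobolev h) (sobolev_mono (min_le_left p q) g.2)
      rwa [sub_add_cancel] at this
    rcases min_choice p q with e | e
    · rw [e] at h hu
      exact ⟨Or.inl hu, g, rfl, Or.inl h⟩
    · rw [e] at h hu
      exact ⟨Or.inr hu, g, rfl, Or.inr h⟩

end Energy

/-! ### Gradients of the admissible functions -/

section Admissible

variable {n : ℕ} {Ω : Set (Rn n)} {m : ℝ}

lemma convex_setOf_sub_mem {X : Type*} [NormedAddCommGroup X] [NormedSpace ℝ X] {S : Set X}
    (hS : Convex ℝ S) (x : X) : Convex ℝ {y | y - x ∈ S} := by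
  intro y hy z hz a b ha hb hab
  have h := hS hy hz ha hb hab
  have e : a • y + b • z - x = a • (y - x) + b • (z - x) := by
    rw [smul_sub, smul_sub, sub_add_sub_comm, ← add_smul, hab, one_smul]
  rw [← e] at h
  exact h

/-- The translate by `G` of the closure of the gradients of test functions. -/
def affineGradients (Ω : Set (Rn n)) (m : ℝ) [Fact (1 ≤ ENNReal.ofReal m)]
    (G : Lp (Rn n) (ENNReal.ofReal m) (volume.restrict Ω)) :
    Set (Lp (Rn n) (ENNReal.ofReal m) (volume.restrict Ω)) :=
  {v | v - G ∈ closure (testGradients Ω m)}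

lemma convex_affineGradients [Fact (1 ≤ ENNReal.ofReal m)]
    (G : Lp (Rn n) (ENNReal.ofReal m) (volume.restrict Ω)) : Convex ℝ (affineGradients Ω m G) :=
  convex_setOf_sub_mem (convex_testGradients m).closure G

lemma isClosed_affineGradients [Fact (1 ≤ ENNReal.ofReal m)]
    (G : Lp (Rn n) (ENNReal.ofReal m) (volume.restrict Ω)) : IsClosed (affineGradients Ω m G) :=
  isClosed_closure.preimage (continuous_id.sub continuous_const)

lemma IsWeakGradient.sub {u w : Fun Ω} {G H : Rn n → Rn n} (h : IsWeakGradient Ω u G)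
    (k : IsWeakGradient Ω w H) : IsWeakGradient Ω (u - w : Fun Ω) (G - H) := by
  refine ((h.add (k.smul (-1))).congr ?_).congr_gradient (Eventually.of_forall fun x => ?_)
  · filter_upwards [AEEqFun.coeFn_sub u w] with x hx
    rw [hx]
    simp [sub_eq_add_neg]
  · simp [sub_eq_add_neg]

lemma exists_mem_affineGradients [Fact (1 ≤ ENNReal.ofReal m)] {u g : Fun Ω}
    {G : Lp (Rn n) (ENNReal.ofReal m) (volume.restrict Ω)} (hg : IsWeakGradient Ω g G)
    (hu : u - g ∈ sobolevZero Ω m) : ∃ v ∈ affineGradients Ω m G, IsWeakGradient Ω u v := by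
  obtain ⟨H, hH, hw⟩ := exists_mem_closure_of_sobolevZero hu
  refine ⟨H + G, ?_, ?_⟩
  · rw [affineGradients, mem_ofPred_eq, add_sub_cancel_right]
    exact hH
  · refine ((hw.add hg).congr ?_).congr_gradient (Lp.coeFn_add H G).symm
    filter_upwards [AEEqFun.coeFn_sub u g] with x hx
    rw [Pi.add_apply, hx, Pi.sub_apply, sub_add_cancel]

/-- Surjectivity of `u ↦ ∇u`: it lets a minimizing field be lifted to a function, and any field
serve as a competitor. -/
lemma exists_sub_mem_sobolevZero [IsFiniteMeasure (volume.restrict Ω)]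
    [Fact (1 ≤ ENNReal.ofReal m)] (hn : 0 < n) (hΩ : Bornology.IsBounded Ω) (hm : 1 < m)
    {g : Fun Ω} {G v : Lp (Rn n) (ENNReal.ofReal m) (volume.restrict Ω)}
    (hg : IsWeakGradient Ω g G) (hv : v ∈ affineGradients Ω m G) :
    ∃ u : Fun Ω, u - g ∈ sobolevZero Ω m ∧ IsWeakGradient Ω u v := by
  obtain ⟨w, hw, hwv⟩ := exists_sobolevZero_of_mem_closure hn hΩ hm hv
  refine ⟨w + g, by rwa [add_sub_cancel_right], ?_⟩
  refine ((hwv.add hg).congr (AEEqFun.coeFn_add w g).symm).congr_gradient ?_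
  filter_upwards [Lp.coeFn_sub v G] with x hx
  rw [Pi.add_apply, hx, Pi.sub_apply, sub_add_cancel]

lemma eq_of_sub_mem_sobolevZero (hn : 0 < n) (hΩo : IsOpen Ω) (hΩ : Bornology.IsBounded Ω)
    (hm : 1 < m) {u u' g : Fun Ω} (hu : u - g ∈ sobolevZero Ω m) (hu' : u' - g ∈ sobolevZero Ω m)
    {v : Rn n → Rn n} (h : IsWeakGradient Ω u v) (h' : IsWeakGradient Ω u' v) : u = u' := by
  have hw : u - u' ∈ sobolevZero Ω m := by
    have := sub_mem hu hu'
    rwa [sub_sub_sub_cancel_right] at this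
  have h0 := h.sub h'
  rw [sub_self] at h0
  exact sub_eq_zero.1 (eq_zero_of_sobolevZero hn hΩo hΩ hm hw h0)

/-- Cutting off the boundary datum near the closure of `A` produces a competitor whose gradient
vanishes in `A`. -/
lemma exists_vanishing_competitor [IsFiniteMeasure (volume.restrict Ω)] {A : Set (Rn n)}
    (hΩo : IsOpen Ω) (hΩ : Bornology.IsBounded Ω) (hA : IsOpen A) (hAΩ : closure A ⊆ Ω) {p : ℝ}
    (hp : 1 < p) {g : Fun Ω} {τ : Rn n → ℝ} (hg : IsTrace Ω p g τ) :
    ∃ (u : Fun Ω) (V : Rn n → Rn n), u - g ∈ sobolevZero Ω p ∧ IsWeakGradient Ω u V ∧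
      MemLp V (ENNReal.ofReal p) (volume.restrict Ω) ∧ ∀ x ∈ A, V x = 0 := by
  obtain ⟨-, G, hgG, hgp, hGp, happ⟩ := hg
  obtain ⟨χ, hχ, hχ1⟩ := exists_isTestC1_eq_one hΩo
    (hΩ.subset (subset_closure.trans hAΩ)).isCompact_closure hAΩ
  obtain ⟨w, hw, hwg, hwp⟩ := exists_sobolevZero_mul hp hgp hGp (fun ε hε => by
    obtain ⟨φ, h1, h2, h3, -⟩ := happ ε hε
    exact ⟨φ, h1, h2, h3⟩) hχ
  -- Here `w` plays the role of `χ g`, so the competitor is `(1 - χ) g`, which vanishes on `A`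
  -- because `χ = 1` on `closure A`.
  refine ⟨g - w, _, ?_, hgG.sub hwg, hGp.sub hwp, fun x hx => ?_⟩
  · rw [sub_sub_cancel_left]
    exact neg_mem hw
  · have h1 : χ =ᶠ[𝓝 x] fun _ => 1 := by
      filter_upwards [hA.mem_nhds hx] with y hy
      exact hχ1 y (subset_closure hy)
    have h2 : gradient χ x = 0 := by
      rw [h1.gradient_eq]
      simp [gradient]
    simp [h2, hχ1 x (subset_closure hx)]

end Admissible

end TwoPhase

open TwoPhase in
theorem mainTheorem4 {n : ℕ} (hn : 2 ≤ n) (Ω A : Set (TwoPhase.Rn n))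
    (hΩ_open : IsOpen Ω) (hΩ_conn : IsConnected Ω) (hΩ_bdd : Bornology.IsBounded Ω)
    (hΩ_lip : TwoPhase.HasLipschitzBoundary Ω)
    (hA_open : IsOpen A) (hA_sub : closure A ⊆ Ω) (hA_lip : TwoPhase.HasLipschitzBoundary A)
    (hA_comp : Finite (ConnectedComponents A)) (hB_conn : IsConnected (Ω \ closure A))
    (p q : ℝ) (hp : 1 < p) (hq : 1 < q) (hpq : p ≠ q)
    (QB QA : TwoPhase.Rn n → ℝ → ℝ)
    (hA1 : TwoPhase.IsCaratheodory (Ω \ closure A) QB ∧ TwoPhase.IsCaratheodory A QA)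
    (hA2 : TwoPhase.IsConvexDensity (Ω \ closure A) QB ∧ TwoPhase.IsConvexDensity A QA)
    (hA3 : ∃ p₀ q₀ c C E₀ : ℝ, 1 < p₀ ∧ p₀ ≤ p ∧ 1 < q₀ ∧ q₀ ≤ q ∧ p₀ ≠ q₀ ∧
      0 < c ∧ 0 < C ∧ 0 < E₀ ∧
      TwoPhase.HasGrowth (Ω \ closure A) QB p₀ p c C E₀ ∧ TwoPhase.HasGrowth A QA q₀ q c C E₀)
    (f : TwoPhase.TraceSpace Ω p) (hf : f ∈ TwoPhase.TraceSpaceZeroMean Ω p) :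
    (∃! u : TwoPhase.Fun Ω, TwoPhase.IsSolution Ω A QB QA p q f u) ∧
      ∀ u : TwoPhase.Fun Ω, TwoPhase.IsSolution Ω A QB QA p q f u →
        u ∈ TwoPhase.sobolev Ω (min p q) := by
  obtain ⟨p₀, q₀, c, C, E₀, hp₀, hp₀p, -, -, -, hc, hC, hE, hB3, hA3⟩ := hA3
  obtain ⟨g, τ, rfl, hτ, -⟩ := hf
  obtain ⟨G, hgG, -, hGp, -⟩ := hτ.2
  have hn0 : 0 < n := by omega
  have : IsFiniteMeasure (volume.restrict Ω) :=
    ⟨by rw [Measure.restrict_apply_univ]; exact hΩ_bdd.measure_lt_top⟩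
  have hadm := mem_admissible_iff hp hq g
  have hm : 1 < min p q := lt_min hp hq
  have hmp : min p q ≤ p := min_le_left p q
  have hmq : min p q ≤ q := min_le_right p q
  -- From here on only `1 < m`, `m ≤ p`, `m ≤ q` and the description of the admissible set in `hadm`
  -- matter.
  generalize min p q = m at *
  have : Fact (1 ≤ ENNReal.ofReal m) := ⟨one_le_ofReal hm.le⟩
  have hQ := isCoerciveIntegrand_twoPhaseDensity hΩ_open hA_open hA_sub hA_lip hA1.1 hA1.2 hA2.1
    hA2.2 hc hE (by linarith) hmp hmq hB3 hA3
  have hGm : MemLp G (ENNReal.ofReal m) (volume.restrict Ω) :=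
    hGp.mono_exponent (ENNReal.ofReal_le_ofReal hmp)
  have hgG' := hgG.congr_gradient (MemLp.coeFn_toLp hGm).symm
  have hen : ∀ {u : Fun Ω} {v : Rn n → Rn n}, IsWeakGradient Ω u v → dirichletEnergy Ω A QB QA u =
      energy (volume.restrict Ω) (twoPhaseDensity A QB QA) v :=
    fun h => dirichletEnergy_eq_energy hΩ_open hA_open hA_sub hA_lip h
  have hfin : ∃ v ∈ affineGradients Ω m (hGm.toLp G),
      energy (volume.restrict Ω) (twoPhaseDensity A QB QA) v ≠ ⊤ := by
    obtain ⟨u, V, hu, hV, hVp, hVA⟩ :=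
      exists_vanishing_competitor hΩ_open hΩ_bdd hA_open hA_sub hp hτ
    obtain ⟨v, hv, hvu⟩ := exists_mem_affineGradients hgG' (sobolevZero_mono hm.le hmp hu)
    refine ⟨v, hv, ?_⟩
    rw [energy_congr (hvu.ae_eq hΩ_open hV)]
    exact energy_ne_top hΩ_open hA_open hA_sub hA_lip hA2.2 hp₀ hp₀p hC hE hB3 hVp hVA
  obtain ⟨v, ⟨hvS, hvmin⟩, hvuniq⟩ := hQ.existsUnique_isMinOn hm (by positivity)
    (isClosed_affineGradients _) (convex_affineGradients _) hfin
  obtain ⟨u, hu, huv⟩ := exists_sub_mem_sobolevZero hn0 hΩ_bdd hm hgG' hvS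
  refine ⟨⟨u, ⟨(hadm u).2 hu, fun u' hu' => ?_⟩, fun u' hu' => ?_⟩, fun u' hu' => ?_⟩
  · obtain ⟨v', hv', huv'⟩ := exists_mem_affineGradients hgG' ((hadm u').1 hu')
    rw [mem_ofPred_eq, hen huv, hen huv']
    exact hvmin v' hv'
  · have hu'g := (hadm u').1 hu'.1
    obtain ⟨v', hv', huv'⟩ := exists_mem_affineGradients hgG' hu'g
    -- The gradient of any solution minimizes over all fields, since each field is the gradient of
    -- an admissible function. Uniqueness of the field then gives uniqueness of the function.
    have e : v' = v := hvuniq v' ⟨hv', fun w hw => by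
      obtain ⟨z, hz, hzw⟩ := exists_sub_mem_sobolevZero hn0 hΩ_bdd hm hgG' hw
      have h := hu'.2 ((hadm z).2 hz)
      rwa [mem_ofPred_eq, hen huv', hen hzw] at h⟩
    rw [e] at huv'
    exact eq_of_sub_mem_sobolevZero hn0 hΩ_open hΩ_bdd hm hu'g hu huv' huv
  -- Admissibility alone suffices here: both Sobolev spaces embed in `W^{1,m}`.
  · rcases hu'.1.1 with h | h
    · exact sobolev_mono hmp h
    · exact sobolev_mono hmq h
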